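/- **Definitions.** Graphs are finite, simple and undirected. A subgraph $H\subseteq G$ is a *$k$-connectivity certificate* of $G$ if for every edge set $F\subseteq E(G)$ with $|F|\le k-1$ the graphs $G\setminus F$ and $H\setminus F$ have the same connected components. An algorithm receives an $n$-node input graph $G$ both as an adjacency list (with the neighbours of each node in arbitrary order, with access to degrees and to the $i$-th neighbour of a node) and as an adjacency matrix. An *adjacency oracle* for $H$ with query time $\tau$ is a data structure that, on every query $(u,v)\in V\times V$, deterministically returns in time at most $\tau$ the bit indicating whether $(u,v)\in E(H)$; queries do not change the data structure and may access $G$ only through its adjacency matrix. Algorithms run on a random access machine that can draw uniform random integers from $\{0,\dots,m-1\}$; time is measured by the logarithmic cost criterion, multiplication and the other arithmetic operations being charged the product of the bit lengths of their operands. $\widetilde O(\cdot)$ hides factors polylogarithmic in $n$. **Theorem (Adjacency oracles for $k$-connectivity certificates).** For every constant $c\ge 0$ there is a randomized algorithm, together with a query algorithm, such that the following holds for all $n\ge1$, all $\varepsilon>0$, all $n$-node graphs $G$ and all $k\ge1$ with $k=\widetilde O(1)$. On input $G$, $k$ and $\lceil 1/\varepsilon\rceil$, the algorithm always halts in time $\widetilde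 O\!\left(n\cdot\max\{1,\varepsilon^{-1}\}\right)$ (that is, $\widetilde O(n\varepsilon^{-1})$ if $\varepsilon\le 1$, and $\widetilde O(n)$ if $\varepsilon>1$), and it always leaves an adjacency oracle, with query time $\widetilde O(1)$, for some subgraph $H\subseteq G$. With probability at least $1-1/n^{c}$, this $H$ is a $k$-connectivity certificate of $G$ with $$|E(H)|\le(1+\varepsilon)kn .$$ (In detail: for every constant $a$ there is a constant $C$ such that for all $n$ and all $k\le a(1+\log n)^a$ the running time is at most $C\,n\max\{1,\varepsilon^{-1}\}(1+\log n)^C$ and the query time is at most $C(1+\log n)^C$.) -/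

import Mathlib

open scoped ENNReal

/-- The adjacency list of a graph on the nodes `0, …, n - 1`: for every node, its neighbours, each
listed once, in an arbitrary order. -/
structure AdjList {n : ℕ} (G : SimpleGraph (Fin n)) where
  nbrs : Fin n → List (Fin n)
  nodup : ∀ v, (nbrs v).Nodup
  mem_nbrs : ∀ v w, w ∈ nbrs v ↔ G.Adj v w

/-- `H` is a `k`-(edge-)connectivity certificate of `G`: it is a subgraph of `G`, and after the
deletion of any at most `k - 1` edges of `G` from both graphs, the connected components of the two
graphs are identical. -/
def IsConnectivityCertificate {V : Type*} (G H : SimpleGraph V) (k : ℕ) : Prop :=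
  H ≤ G ∧ ∀ F : Finset (Sym2 V), (F : Set (Sym2 V)) ⊆ G.edgeSet → F.card < k →
    ∀ u v, (G.deleteEdges F).Reachable u v ↔ (H.deleteEdges F).Reachable u v

/-! ### Randomized random access machines with access to a graph

Programs are structured programs over natural-number registers and a memory of natural-number cells.
The running time is measured by the logarithmic cost criterion: an operation costs at least 1, and
at least as many time units as the numbers and addresses that take part in it have binary digits. -/

namespace RAM

/-- The arithmetic operations and comparisons of the machine. -/
inductive Op where
  | add | sub | mul | div | mod | lt | eq

/-- The value of an operation: subtraction is truncated, a comparison returns 1 or 0. -/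
def Op.eval : Op → ℕ → ℕ → ℕ
  | .add, x, y => x + y
  | .sub, x, y => x - y
  | .mul, x, y => x * y
  | .div, x, y => x / y
  | .mod, x, y => x % y
  | .lt, x, y => if x < y then 1 else 0
  | .eq, x, y => if x = y then 1 else 0

/-- Expressions: constants, registers, operations, memory cells, and the three kinds of access to
the input graph: the length of the adjacency list of `v`, its `i`-th entry (counted from 0), and the
entry `(u, v)` of the adjacency matrix. -/
inductive Exp where
  | lit (c : ℕ)
  | reg (x : ℕ)
  | op (o : Op) (e₁ e₂ : Exp)
  | load (e : Exp)
  | deg (v : Exp)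
  | nbr (v i : Exp)
  | adj (u v : Exp)

/-- Programs; `rand x e` draws a uniformly random number from `{0, …, m - 1}`, `m` being the value
of `e`, and a condition holds if its value is not 0. -/
inductive Prog where
  | skip
  | assign (x : ℕ) (e : Exp)
  | store (e₁ e₂ : Exp)
  | rand (x : ℕ) (e : Exp)
  | seq (p q : Prog)
  | ite (e : Exp) (p q : Prog)
  | loop (e : Exp) (p : Prog)

/-- Registers, memory, and the time that has passed. -/
structure State where
  reg : ℕ → ℕ
  mem : ℕ → ℕ
  time : ℕ

/-- Let `t` time units pass. -/
def State.tick (s : State) (t : ℕ) : State := { s with time := s.time + t }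

/-- Write `a` into register `x`. -/
def State.setReg (s : State) (x a : ℕ) : State := { s with reg := Function.update s.reg x a }

/-- Write `a` into the memory cell with address `i`. -/
def State.setMem (s : State) (i a : ℕ) : State := { s with mem := Function.update s.mem i a }

/-- The machine starts at time 0 with the input in registers 0, 1, 2, …; all other registers are
0. -/
def State.init (input : List ℕ) (mem : ℕ → ℕ) : State where
  reg := fun x => input.getD x 0
  mem := mem
  time := 0

section Semantics

variable {n : ℕ} {G : SimpleGraph (Fin n)} (L : AdjList G)

/-- The degree of node `v` (0 if there is no such node). -/
def degQuery (v : ℕ) : ℕ := if h : v < n then (L.nbrs ⟨v, h⟩).length else 0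

/-- The `i`-th neighbour of node `v` (0 if there is none). -/
def nbrQuery (v i : ℕ) : ℕ :=
  if h : v < n then ((L.nbrs ⟨v, h⟩)[i]?.map Fin.val).getD 0 else 0

open Classical in
/-- The entry `(u, v)` of the adjacency matrix (0 if `u` or `v` is not a node). -/
noncomputable def adjQuery (_L : AdjList G) (u v : ℕ) : ℕ :=
  if ∃ (hu : u < n) (hv : v < n), G.Adj ⟨u, hu⟩ ⟨v, hv⟩ then 1 else 0

/-- The value of an expression. -/
noncomputable def Exp.eval (s : State) : Exp → ℕ
  | .lit c => c
  | .reg x => s.reg x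
  | .op o e₁ e₂ => o.eval (e₁.eval s) (e₂.eval s)
  | .load e => s.mem (e.eval s)
  | .deg v => degQuery L (v.eval s)
  | .nbr v i => nbrQuery L (v.eval s) (i.eval s)
  | .adj u v => adjQuery L (u.eval s) (v.eval s)

/-- The time that the evaluation of an expression takes; `Nat.size` is the number of binary
digits. An operation is charged as for the schoolbook algorithm for multiplication. -/
noncomputable def Exp.cost (s : State) : Exp → ℕ
  | .lit c => 1 + c.size
  | .reg x => 1 + (s.reg x).size
  | .op _ e₁ e₂ =>
      e₁.cost s + e₂.cost s + ((e₁.eval L s).size + 1) * ((e₂.eval L s).size + 1)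
  | .load e => e.cost s + 1 + (e.eval L s).size + (s.mem (e.eval L s)).size
  | .deg v => v.cost s + 1 + (v.eval L s).size + (degQuery L (v.eval L s)).size
  | .nbr v i =>
      v.cost s + i.cost s + 1 + (v.eval L s).size + (i.eval L s).size
        + (nbrQuery L (v.eval L s) (i.eval L s)).size
  | .adj u v => u.cost s + v.cost s + 1 + (u.eval L s).size + (v.eval L s).size

/-- The loop `while e do body`, where `body` is given by its effect; `none` if more than `fuel`
evaluations of the condition would be needed. -/
noncomputable def whileLoop (e : Exp) (body : State → PMF (Option State)) :
    ℕ → State → PMF (Option State)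
  | 0, _ => PMF.pure none
  | fuel + 1, s =>
      if e.eval L s = 0 then PMF.pure (some (s.tick (1 + e.cost L s)))
      else (body (s.tick (1 + e.cost L s))).bind
        (fun o => o.elim (PMF.pure none) (whileLoop e body fuel))

/-- The distribution of the final state of a program that is started in state `s`; the outcome
`none` means that some loop has been abandoned because it evaluated its condition `fuel` times
without leaving, so an outcome `some s'` is the true result of a complete run, whatever `fuel` is.
(A random draw from an empty range returns 0.) -/
noncomputable def Prog.run (fuel : ℕ) : Prog → State → PMF (Option State)
  | .skip, s => PMF.pure (some (s.tick 1))
  | .assign x e, s => PMF.pure (some ((s.setReg x (e.eval L s)).tick (1 + e.cost L s)))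
  | .store e₁ e₂, s =>
      PMF.pure (some ((s.setMem (e₁.eval L s) (e₂.eval L s)).tick
        (1 + e₁.cost L s + e₂.cost L s + (e₁.eval L s).size + (e₂.eval L s).size)))
  | .rand x e, s =>
      (PMF.uniformOfFintype (Fin (e.eval L s - 1 + 1))).map
        (fun i => some ((s.setReg x i).tick (1 + e.cost L s + (e.eval L s).size)))
  | .seq p q, s => (p.run fuel s).bind (fun o => o.elim (PMF.pure none) (q.run fuel))
  | .ite e p q, s =>
      if e.eval L s = 0 then q.run fuel (s.tick (1 + e.cost L s))
      else p.run fuel (s.tick (1 + e.cost L s))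
  | .loop e p, s => whileLoop L e (p.run fuel) fuel s

end Semantics

/-- The expression uses the input graph only through its adjacency matrix. -/
def Exp.OnlyMatrix : Exp → Prop
  | .lit _ => True
  | .reg _ => True
  | .op _ e₁ e₂ => e₁.OnlyMatrix ∧ e₂.OnlyMatrix
  | .load e => e.OnlyMatrix
  | .deg _ => False
  | .nbr _ _ => False
  | .adj u v => u.OnlyMatrix ∧ v.OnlyMatrix

/-- The programs that may answer queries: they are deterministic, do not write into the memory, and
use the input graph only through its adjacency matrix. -/
def Prog.IsQuery : Prog → Prop
  | .skip => True
  | .assign _ e => e.OnlyMatrix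
  | .store _ _ => False
  | .rand _ _ => False
  | .seq p q => p.IsQuery ∧ q.IsQuery
  | .ite e p q => e.OnlyMatrix ∧ p.IsQuery ∧ q.IsQuery
  | .loop e p => e.OnlyMatrix ∧ p.IsQuery

open Classical in
/-- The memory contents `mem`, queried by the program `Q`, are an adjacency oracle for `H` with
query time at most `τ`: started with `u` and `v` in registers 0 and 1 and with all its other
registers 0, the program `Q` halts within time `τ`, leaving in register 0 the bit that says whether
`uv` is an edge of `H`. -/
def IsAdjacencyOracle {n : ℕ} {G : SimpleGraph (Fin n)} (L : AdjList G) (Q : Prog) (mem : ℕ → ℕ)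
    (τ : ℝ) (H : SimpleGraph (Fin n)) : Prop :=
  Q.IsQuery ∧ ∀ u v : Fin n, ∃ (fuel : ℕ) (s : State),
    Q.run L fuel (State.init [(u : ℕ), (v : ℕ)] mem) = PMF.pure (some s) ∧
    (s.time : ℝ) ≤ τ ∧ s.reg 0 = if H.Adj u v then 1 else 0

/-- The distribution of the outcome of the preprocessing program `P` on the input `(G, k, ε)`.
Registers 0, 1, 2 hold `n`, `k` and `⌈1 / ε⌉`; all other registers and the memory are 0. -/
noncomputable def preprocess {n : ℕ} {G : SimpleGraph (Fin n)} (L : AdjList G) (P : Prog)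
    (k : ℕ) (ε : ℝ) (fuel : ℕ) : PMF (Option State) :=
  P.run L fuel (State.init [n, k, ⌈1 / ε⌉₊] (fun _ => 0))

end RAM

/-! The certificate is built in `k` levels. Level `i` grows a forest in the graph `rest G i` of the
edges left over by the earlier levels; an edge survives a level if it is not in the forest and its
ends lie in one component of the forest. The certificate `G \ rest G k` thus consists of forest
edges and of edges that cross between components at some level. The ends of any other edge are
connected in each of `k` edge-disjoint forests, and fewer than `k` deletions spare one of these
(`isConnectivityCertificate`). A forest has at most `n - 1` edges, so the size bound needs only that
each level has at most about `ε * n` crossing edges.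

The forests therefore need not be spanning, and sampling suffices: draw a random node and a random
neighbour, and add the edge if it survived so far and joins two components. To see that few crossing
edges remain, keep a set `W` of nodes and call a class (component met with `W`) active if a sample
at its nodes is likely enough to lead to another class inside `W`. Inactive classes are removed from
`W`; their outgoing edges are few compared with their size and the edges lost or charged earlier, so
these edges can be charged (`Charged.remove_class`, `Charged.exists_active`). When all classes are
active, a sample merges two of them with probability at least their number divided by `n * (4 * k *
e + 2)`, so their expected number decays geometrically (`sample_iterate_le`). Once `W` is empty, the
charging leaves at most `n / e` crossing edges (`Sparse.succ_of_charged`), where `e` is `⌈1 / ε⌉`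
capped at `n`.

Components are stored by union by size, so a query compares roots at `k` levels and looks up one bit
for forest membership. Programs are analysed through the expectation of a function that is infinite
on abandoned runs and on states violating the invariants. Its finiteness gives the claims that
always hold; Markov's inequality gives the probability. -/

namespace PMF

/-! ### Expectations with respect to discrete distributions. -/

/-- The expected value of an extended nonnegative function. -/
noncomputable def expect {α : Type*} (p : PMF α) (f : α → ℝ≥0∞) : ℝ≥0∞ := ∑' a, p a * f a

theorem expect_pure {α : Type*} (a : α) (f : α → ℝ≥0∞) : (PMF.pure a).expect f = f a := by
  classical
  unfold expect
  rw [tsum_eq_single a]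
  · simp
  · intro b hb
    simp [PMF.pure_apply, hb]

theorem expect_bind {α β : Type*} (p : PMF α) (q : α → PMF β) (f : β → ℝ≥0∞) :
    (p.bind q).expect f = p.expect fun a => (q a).expect f := by
  unfold expect
  simp only [PMF.bind_apply, ← ENNReal.tsum_mul_right, ← ENNReal.tsum_mul_left]
  rw [ENNReal.tsum_comm]
  simp only [mul_assoc]

theorem expect_map {α β : Type*} (p : PMF α) (g : α → β) (f : β → ℝ≥0∞) :
    (p.map g).expect f = p.expect (f ∘ g) := by
  unfold PMF.map
  rw [expect_bind]
  simp only [Function.comp_apply, expect_pure]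
  rfl

theorem expect_mono {α : Type*} (p : PMF α) {f g : α → ℝ≥0∞} (h : ∀ a, f a ≤ g a) :
    p.expect f ≤ p.expect g :=
  ENNReal.tsum_le_tsum fun a => mul_le_mul_right (h a) _

theorem expect_uniformOfFintype {α : Type*} [Fintype α] [Nonempty α] (f : α → ℝ≥0∞) :
    (PMF.uniformOfFintype α).expect f = (Fintype.card α : ℝ≥0∞)⁻¹ * ∑ a, f a := by
  unfold expect
  rw [tsum_fintype, Finset.mul_sum]
  simp

end PMF

/-! ### Cost of expressions and rules for reasoning about programs. -/

namespace RAM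

/-- Digits of the value of an expression, in multiples of `B + 1`, if all numbers of the state have
at most `B` digits. -/
def Exp.wid : Exp → ℕ
  | .lit c => c
  | .op _ a b => a.wid + b.wid + 1
  | _ => 1

/-- Cost of an expression, in multiples of `(B + 1) ^ 2`, if all numbers of the state have at most
`B` digits. -/
def Exp.wt : Exp → ℕ
  | .lit c => 1 + c
  | .reg _ => 2
  | .op _ a b => a.wt + b.wt + (a.wid + 1) * (b.wid + 1)
  | .load e => e.wt + e.wid + 2
  | .deg v => v.wt + v.wid + 2
  | .nbr v i => v.wt + i.wt + v.wid + i.wid + 2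
  | .adj u v => u.wt + v.wt + u.wid + v.wid + 2

theorem size_le_size_add_size_add_one {x y z : ℕ} (h : z ≤ x + y ∨ z ≤ x * y) :
    z.size ≤ x.size + y.size + 1 := by
  rw [Nat.size_le]
  have hx := Nat.lt_size_self x
  have hy := Nat.lt_size_self y
  rw [pow_succ, pow_add]
  have h1 : 1 ≤ 2 ^ x.size := Nat.one_le_two_pow
  have h2 : 1 ≤ 2 ^ y.size := Nat.one_le_two_pow
  rcases h with h | h
  · nlinarith
  · have := Nat.mul_lt_mul'' hx hy
    omega

theorem Op.size_eval_le (o : Op) (x y : ℕ) : (o.eval x y).size ≤ x.size + y.size + 1 := by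
  have one : (1 : ℕ).size ≤ x.size + y.size + 1 := by simp
  cases o
  · exact size_le_size_add_size_add_one (Or.inl le_rfl)
  · exact size_le_size_add_size_add_one (Or.inl (by simp only [Op.eval]; omega))
  · exact size_le_size_add_size_add_one (Or.inr le_rfl)
  · exact size_le_size_add_size_add_one
      (Or.inl ((Nat.div_le_self x y).trans (Nat.le_add_right _ _)))
  · exact size_le_size_add_size_add_one
      (Or.inl ((Nat.mod_le x y).trans (Nat.le_add_right _ _)))
  · simp only [Op.eval]; split_ifs <;> simp
  · simp only [Op.eval]; split_ifs <;> simp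

/-- All numbers of the state, and the number `n` of nodes, are at most `M`. -/
structure Bdd (n M : ℕ) (r m : ℕ → ℕ) : Prop where
  nodes : n ≤ M
  reg : ∀ x, r x ≤ M
  mem : ∀ i, m i ≤ M

theorem Bdd.setReg {n M : ℕ} {r m : ℕ → ℕ} (h : Bdd n M r m) (x : ℕ) {a : ℕ} (ha : a ≤ M) :
    Bdd n M (Function.update r x a) m :=
  ⟨h.nodes, fun y => by
    rcases eq_or_ne y x with rfl | hy
    · simpa using ha
    · simpa [hy] using h.reg y, h.mem⟩

theorem Bdd.setMem {n M : ℕ} {r m : ℕ → ℕ} (h : Bdd n M r m) (i : ℕ) {a : ℕ} (ha : a ≤ M) :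
    Bdd n M r (Function.update m i a) :=
  ⟨h.nodes, h.reg, fun y => by
    rcases eq_or_ne y i with rfl | hy
    · simpa using ha
    · simpa [hy] using h.mem y⟩

section Logic

variable {n : ℕ} {G : SimpleGraph (Fin n)} (L : AdjList G)

theorem degQuery_le (v : ℕ) : degQuery L v ≤ n := by
  unfold degQuery
  split_ifs
  · exact (L.nodup _).length_le_card.trans_eq (Fintype.card_fin n)
  · exact Nat.zero_le _

theorem nbrQuery_le (v i : ℕ) : nbrQuery L v i ≤ n := by
  unfold nbrQuery
  split_ifs with h
  · rcases (L.nbrs ⟨v, h⟩)[i]? with _ | w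
    · simp
    · simp [w.2.le]
  · exact Nat.zero_le _

theorem adjQuery_le (u v : ℕ) : adjQuery L u v ≤ 1 := by
  unfold adjQuery
  split_ifs <;> simp

theorem Exp.size_eval_le {M : ℕ} (s : State) (hB : Bdd n M s.reg s.mem) (e : Exp) :
    (e.eval L s).size ≤ e.wid * (M.size + 1) := by
  have key : ∀ x ≤ M, x.size ≤ 1 * (M.size + 1) := fun x hx => by
    have := Nat.size_le_size hx
    omega
  induction e with
  | lit c =>
    have hc : c.size ≤ c := Nat.size_le.2 Nat.lt_two_pow_self
    simp only [Exp.eval, Exp.wid]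
    nlinarith [Nat.zero_le (c * M.size)]
  | reg x => exact key _ (hB.reg x)
  | op o a b ha hb =>
    simp only [Exp.eval, Exp.wid]
    have := o.size_eval_le (a.eval L s) (b.eval L s)
    nlinarith
  | load e => exact key _ (hB.mem _)
  | deg v => exact key _ ((degQuery_le L _).trans hB.nodes)
  | nbr v i => exact key _ ((nbrQuery_le L _ _).trans hB.nodes)
  | adj u v =>
    have : (adjQuery L (u.eval L s) (v.eval L s)).size ≤ (1 : ℕ).size :=
      Nat.size_le_size (adjQuery_le L _ _)
    simp only [Nat.size_one] at this
    simp only [Exp.eval, Exp.wid]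
    omega

/-- Operations are charged the product of two digit counts, hence the square. As `wt` depends on the
program text only, bounding running times reduces to counting steps. -/
theorem Exp.cost_le {M : ℕ} (s : State) (hB : Bdd n M s.reg s.mem) (e : Exp) :
    e.cost L s ≤ e.wt * (M.size + 1) ^ 2 := by
  have key : ∀ x ≤ M, 1 + x.size ≤ 2 * (M.size + 1) ^ 2 := fun x hx => by
    have := Nat.size_le_size hx
    nlinarith
  have hU : M.size + 1 ≤ (M.size + 1) ^ 2 := by nlinarith
  have wide : ∀ e : Exp, (e.eval L s).size ≤ e.wid * (M.size + 1) ^ 2 := fun e =>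
    (Exp.size_eval_le L s hB e).trans (Nat.mul_le_mul_left _ hU)
  have one : 1 ≤ (M.size + 1) ^ 2 := Nat.one_le_pow _ _ (Nat.succ_pos _)
  induction e with
  | lit c =>
    have hc : c.size ≤ c := Nat.size_le.2 Nat.lt_two_pow_self
    simp only [Exp.cost, Exp.wt]
    nlinarith
  | reg x =>
    simp only [Exp.cost, Exp.wt]
    exact key _ (hB.reg x)
  | op o a b ha hb =>
    simp only [Exp.cost, Exp.wt]
    have h1 : (a.eval L s).size + 1 ≤ (a.wid + 1) * (M.size + 1) := by
      have := Exp.size_eval_le L s hB a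
      nlinarith
    have h2 : (b.eval L s).size + 1 ≤ (b.wid + 1) * (M.size + 1) := by
      have := Exp.size_eval_le L s hB b
      nlinarith
    calc _ ≤ a.wt * (M.size + 1) ^ 2 + b.wt * (M.size + 1) ^ 2
          + ((a.wid + 1) * (M.size + 1)) * ((b.wid + 1) * (M.size + 1)) :=
          add_le_add (add_le_add ha hb) (Nat.mul_le_mul h1 h2)
      _ = _ := by ring
  | load e ih =>
    simp only [Exp.cost, Exp.wt]
    have := wide e
    have := key _ (hB.mem (e.eval L s))
    linarith
  | deg v ih =>
    simp only [Exp.cost, Exp.wt]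
    have := wide v
    have := key _ ((degQuery_le L (v.eval L s)).trans hB.nodes)
    linarith
  | nbr v i hv hi =>
    simp only [Exp.cost, Exp.wt]
    have := wide v
    have := wide i
    have := key _ ((nbrQuery_le L (v.eval L s) (i.eval L s)).trans hB.nodes)
    linarith
  | adj u v hu hv =>
    simp only [Exp.cost, Exp.wt]
    have := wide u
    have := wide v
    linarith

/-! ### Deterministic programs -/

/-- From registers `r` and memory `m`, at any time, the program halts within time `T`, and the final
registers and memory satisfy `Q`. -/
def Halts (fuel : ℕ) (p : Prog) (T : ℕ) (r m : ℕ → ℕ) (Q : (ℕ → ℕ) → (ℕ → ℕ) → Prop) : Prop :=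
  ∀ t, ∃ s, p.run L fuel ⟨r, m, t⟩ = PMF.pure (some s) ∧ s.time ≤ t + T ∧ Q s.reg s.mem

variable {L} {fuel : ℕ} {r m : ℕ → ℕ} {Q Q' : (ℕ → ℕ) → (ℕ → ℕ) → Prop}

theorem Halts.mono {p : Prog} {T T' : ℕ} (h : Halts L fuel p T r m Q) (hT : T ≤ T')
    (hQ : ∀ r' m', Q r' m' → Q' r' m') : Halts L fuel p T' r m Q' := fun t => by
  obtain ⟨s, h1, h2, h3⟩ := h t
  exact ⟨s, h1, by omega, hQ _ _ h3⟩

theorem Halts.seq {p q : Prog} {T₁ T₂ T : ℕ}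
    (h : Halts L fuel p T₁ r m fun r' m' => Halts L fuel q T₂ r' m' Q) (hT : T₁ + T₂ ≤ T) :
    Halts L fuel (.seq p q) T r m Q := fun t => by
  obtain ⟨s, h1, h2, h3⟩ := h t
  obtain ⟨s', h1', h2', h3'⟩ := h3 s.time
  refine ⟨s', ?_, by omega, h3'⟩
  simp only [Prog.run, h1, PMF.pure_bind, Option.elim]
  exact h1'

theorem eval_time (e : Exp) (t t' : ℕ) : e.eval L ⟨r, m, t⟩ = e.eval L ⟨r, m, t'⟩ := by
  induction e <;> simp_all [Exp.eval]

/-- The bound for the time of one step of a program whose expressions have weight less than `K`. -/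
def unit (K M : ℕ) : ℕ := K * (M.size + 1) ^ 2

theorem one_add_cost_le {K M : ℕ} {e : Exp} (t : ℕ) (hB : Bdd n M r m) (he : e.wt < K) :
    1 + e.cost L ⟨r, m, t⟩ ≤ unit K M := by
  have h := Exp.cost_le L ⟨r, m, t⟩ hB e
  have one : 1 ≤ (M.size + 1) ^ 2 := Nat.one_le_pow _ _ (Nat.succ_pos _)
  unfold unit
  nlinarith

theorem Halts.skip {T : ℕ} (hT : 1 ≤ T) (h : Q r m) : Halts L fuel .skip T r m Q :=
  fun t => ⟨_, rfl, by simpa [State.tick] using hT, h⟩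

theorem Halts.assign {K M x : ℕ} {e : Exp} (hB : Bdd n M r m) (he : e.wt < K)
    (h : Q (Function.update r x (e.eval L ⟨r, m, 0⟩)) m) :
    Halts L fuel (.assign x e) (unit K M) r m Q := fun t => by
  refine ⟨_, rfl, ?_, ?_⟩
  · have := one_add_cost_le (L := L) t hB he
    simp only [State.tick, State.setReg]
    omega
  · simpa [State.tick, State.setReg, eval_time e t 0] using h

theorem Halts.store {K M : ℕ} {e₁ e₂ : Exp} (hB : Bdd n M r m)
    (he : e₁.wt + e₂.wt + e₁.wid + e₂.wid < K)
    (h : Q r (Function.update m (e₁.eval L ⟨r, m, 0⟩) (e₂.eval L ⟨r, m, 0⟩))) :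
    Halts L fuel (.store e₁ e₂) (unit K M) r m Q := fun t => by
  refine ⟨_, rfl, ?_, ?_⟩
  · have h1 := Exp.cost_le L ⟨r, m, t⟩ hB e₁
    have h2 := Exp.cost_le L ⟨r, m, t⟩ hB e₂
    have h3 := Exp.size_eval_le L ⟨r, m, t⟩ hB e₁
    have h4 := Exp.size_eval_le L ⟨r, m, t⟩ hB e₂
    have hU : M.size + 1 ≤ (M.size + 1) ^ 2 := by nlinarith
    have h5 := Nat.mul_le_mul_left e₁.wid hU
    have h6 := Nat.mul_le_mul_left e₂.wid hU
    have h7 := Nat.mul_le_mul_right ((M.size + 1) ^ 2) he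
    simp only [State.tick, State.setMem, unit]
    nlinarith
  · simpa [State.tick, State.setMem, eval_time _ t 0] using h

theorem Halts.ite {K M T T' : ℕ} {e : Exp} {p q : Prog} (hB : Bdd n M r m) (he : e.wt < K)
    (hT : unit K M + T ≤ T')
    (hp : e.eval L ⟨r, m, 0⟩ ≠ 0 → Halts L fuel p T r m Q)
    (hq : e.eval L ⟨r, m, 0⟩ = 0 → Halts L fuel q T r m Q) :
    Halts L fuel (.ite e p q) T' r m Q := fun t => by
  have hc := one_add_cost_le (L := L) t hB he
  simp only [Prog.run, State.tick, eval_time e t 0]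
  split_ifs with h0
  · obtain ⟨s, h1, h2, h3⟩ := hq h0 (t + (1 + e.cost L ⟨r, m, t⟩))
    exact ⟨s, h1, by omega, h3⟩
  · obtain ⟨s, h1, h2, h3⟩ := hp h0 (t + (1 + e.cost L ⟨r, m, t⟩))
    exact ⟨s, h1, by omega, h3⟩

/-- The index of `I` is a budget of remaining rounds. The condition is evaluated at most `j + 1`
times, which is why `j < fuel` is enough. -/
theorem Halts.loop {K M T T' j : ℕ} {e : Exp} {p : Prog} {I : ℕ → (ℕ → ℕ) → (ℕ → ℕ) → Prop}
    (he : e.wt < K) (hf : j < fuel) (hT : (j + 1) * unit K M + j * T ≤ T') (h : I j r m)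
    (hB : ∀ j r m, I j r m → Bdd n M r m)
    (hexit : ∀ j r m, I j r m → e.eval L ⟨r, m, 0⟩ = 0 → Q r m)
    (hstep : ∀ j r m, I j r m → e.eval L ⟨r, m, 0⟩ ≠ 0 →
      ∃ j', j = j' + 1 ∧ Halts L fuel p T r m (I j')) :
    Halts L fuel (.loop e p) T' r m Q := by
  have key : ∀ f j r m, j < f → I j r m → ∀ t, ∃ s,
      whileLoop L e (p.run L fuel) f ⟨r, m, t⟩ = PMF.pure (some s) ∧
      s.time ≤ t + ((j + 1) * unit K M + j * T) ∧ Q s.reg s.mem := by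
    intro f
    induction f with
    | zero => intro j r m hj; omega
    | succ f ih =>
      intro j r m hj hI t
      have hc := one_add_cost_le (L := L) t (hB _ _ _ hI) he
      simp only [whileLoop, State.tick, eval_time e t 0]
      split_ifs with h0
      · refine ⟨_, rfl, ?_, hexit _ _ _ hI h0⟩
        dsimp only
        nlinarith
      · obtain ⟨j', rfl, hj'⟩ := hstep _ _ _ hI h0
        obtain ⟨s, h1, h2, h3⟩ := hj' (t + (1 + e.cost L ⟨r, m, t⟩))
        obtain ⟨s', h1', h2', h3'⟩ := ih j' s.reg s.mem (by omega) h3 s.time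
        refine ⟨s', ?_, ?_, h3'⟩
        · rw [h1, PMF.pure_bind]
          exact h1'
        · nlinarith
  intro t
  obtain ⟨s, h1, h2, h3⟩ := key fuel j r m hf h t
  exact ⟨s, h1, by omega, h3⟩

/-! ### Randomized programs -/

variable (L) in
/-- The expected value of `f` in the final state, where an abandoned run counts as infinite. -/
noncomputable def wp (fuel : ℕ) (p : Prog) (f : State → ℝ≥0∞) (s : State) : ℝ≥0∞ :=
  (p.run L fuel s).expect fun o => o.elim ⊤ f

theorem wp_seq (p q : Prog) (f : State → ℝ≥0∞) (s : State) :
    wp L fuel (.seq p q) f s = wp L fuel p (wp L fuel q f) s := by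
  simp only [wp, Prog.run, PMF.expect_bind]
  congr 1
  funext o
  cases o <;> simp [PMF.expect_pure, wp]

theorem wp_rand (x : ℕ) (e : Exp) (f : State → ℝ≥0∞) (s : State) :
    wp L fuel (.rand x e) f s = ((e.eval L s - 1 + 1 : ℕ) : ℝ≥0∞)⁻¹ *
      ∑ i : Fin (e.eval L s - 1 + 1),
        f ((s.setReg x i).tick (1 + e.cost L s + (e.eval L s).size)) := by
  simp only [wp, Prog.run, PMF.expect_map]
  refine (PMF.expect_bind (PMF.uniformOfFintype (Fin (e.eval L s - 1 + 1)))
    (fun i => PMF.pure (i : ℕ)) _).trans ?_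
  simp only [PMF.expect_pure, PMF.expect_uniformOfFintype, Fintype.card_fin]
  rfl

theorem Halts.wp_le {p : Prog} {T t : ℕ} (h : Halts L fuel p T r m Q) {f : State → ℝ≥0∞}
    {b : ℝ≥0∞} (hf : ∀ r' m' t', t' ≤ t + T → Q r' m' → f ⟨r', m', t'⟩ ≤ b) :
    wp L fuel p f ⟨r, m, t⟩ ≤ b := by
  obtain ⟨s, h1, h2, h3⟩ := h t
  rw [wp, h1, PMF.expect_pure]
  exact hf _ _ _ h2 h3

/-- `J j` is a potential for at most `j` further rounds that must not increase in expectation. The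
value `⊤` marks states outside the invariant, where nothing has to be shown. -/
theorem wp_loop {e : Exp} {p : Prog} {f : State → ℝ≥0∞} {J : ℕ → State → ℝ≥0∞}
    (hexit : ∀ j s, J j s ≠ ⊤ → e.eval L s = 0 → f (s.tick (1 + e.cost L s)) ≤ J j s)
    (hstep : ∀ j s, J j s ≠ ⊤ → e.eval L s ≠ 0 →
      ∃ j', j = j' + 1 ∧ wp L fuel p (J j') (s.tick (1 + e.cost L s)) ≤ J j s)
    {j : ℕ} (hj : j < fuel) (s : State) : wp L fuel (.loop e p) f s ≤ J j s := by
  have key : ∀ g j s, j < g →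
      (whileLoop L e (p.run L fuel) g s).expect (fun o => o.elim ⊤ f) ≤ J j s := by
    intro g
    induction g with
    | zero => intro j s hj; omega
    | succ g ih =>
      intro j s hj
      by_cases hJ : J j s = ⊤
      · rw [hJ]; exact le_top
      unfold whileLoop
      split_ifs with h0
      · rw [PMF.expect_pure]
        exact hexit j s hJ h0
      · obtain ⟨j', rfl, hj'⟩ := hstep j s hJ h0
        rw [PMF.expect_bind]
        refine le_trans (PMF.expect_mono _ fun o => ?_) hj'
        cases o with
        | none => simp
        | some s' => exact ih j' s' (by omega)
  exact key fuel j s hj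

end Logic

end RAM

/-! ### The charging argument for inactive classes. -/

namespace SimpleGraph

open scoped Classical

variable {n : ℕ}

/-- The edges of `K` between different classes of the labelling `l`. -/
def cross (K : SimpleGraph (Fin n)) (l : Fin n → Fin n) : SimpleGraph (Fin n) where
  Adj u v := K.Adj u v ∧ l u ≠ l v
  symm := ⟨fun _ _ h => ⟨h.1.symm, h.2.symm⟩⟩
  loopless := ⟨fun _ h => h.2 rfl⟩

/-- The number of edges of `cross K l` from `v` to nodes of `W`. -/
noncomputable def outDegree (K : SimpleGraph (Fin n)) (l : Fin n → Fin n) (W : Finset (Fin n))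
    (v : Fin n) : ℕ :=
  (W.filter fun w => (K.cross l).Adj v w).card

/-- The edges of `K` that have a node outside of `W` and that lead to `W` or to another class can be
charged to the nodes outside of `W`. -/
def Charged (G K : SimpleGraph (Fin n)) (t : ℕ) (l : Fin n → Fin n) (W : Finset (Fin n)) : Prop :=
  ∃ Z : Finset (Fin n × Fin n), (∀ p ∈ Z, p.1 ∉ W) ∧
    (∀ u ∉ W, ∀ w ∈ W, K.Adj u w → (u, w) ∈ Z) ∧
    (∀ u ∉ W, ∀ w ∉ W, (K.cross l).Adj u w → (u, w) ∈ Z ∨ (w, u) ∈ Z) ∧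
    t * Z.card ≤ ∑ u ∈ Wᶜ, (1 + (G \ K).degree u) + (Z.filter fun p => p.2 ∉ W).card

/-- The probability, up to normalization, that a random edge at a random node of the class `c`
leads to a node of `W` in another class. -/
noncomputable def activity (G K : SimpleGraph (Fin n)) (l : Fin n → Fin n) (W : Finset (Fin n))
    (c : Fin n) : ℝ :=
  ∑ v ∈ W.filter (l · = c), (K.outDegree l W v : ℝ) / G.degree v

variable {G K : SimpleGraph (Fin n)} {t : ℕ} {l l' : Fin n → Fin n} {W : Finset (Fin n)}

theorem charged_univ : Charged G K t l Finset.univ :=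
  ⟨∅, by simp, by simp, by simp, by simp⟩

/-- A coarser labelling has fewer crossing edges, and the other conditions on `Z` do not mention
labels, so the same `Z` serves. -/
theorem Charged.of_refines (h : Charged G K t l W) (hl : ∀ u v, l u = l v → l' u = l' v) :
    Charged G K t l' W := by
  obtain ⟨Z, h1, h2, h3, h4⟩ := h
  exact ⟨Z, h1, h2, fun u hu w hw hK => h3 u hu w hw ⟨hK.1, fun h => hK.2 (hl _ _ h)⟩, h4⟩

theorem card_filter_product {α : Type*} (S T : Finset α) (R : α → α → Prop) :
    ((S ×ˢ T).filter fun p => R p.1 p.2).card = ∑ v ∈ S, (T.filter (R v)).card := by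
  simp only [Finset.card_filter, Finset.sum_product]

theorem degree_le_of_mem (c : Fin n) {v : Fin n} (hv : v ∈ W.filter (l · = c)) :
    G.degree v ≤ K.outDegree l W v + (W.filter (l · = c)).card
      + (Wᶜ.filter fun u => K.Adj v u).card + (G \ K).degree v := by
  have hvc := (Finset.mem_filter.1 hv).2
  have : G.neighborFinset v ⊆ (((W.filter fun w => (K.cross l).Adj v w) ∪ W.filter (l · = c)) ∪
      (Wᶜ.filter fun u => K.Adj v u)) ∪ (G \ K).neighborFinset v := by
    intro w hw
    rw [SimpleGraph.mem_neighborFinset] at hw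
    simp only [Finset.mem_union, Finset.mem_filter, Finset.mem_compl, mem_neighborFinset,
      SimpleGraph.sdiff_adj, cross]
    by_cases hK : K.Adj v w <;> by_cases hW : w ∈ W <;> by_cases hc : l w = c <;> simp_all
    exact fun h => hc h.symm
  rw [← SimpleGraph.card_neighborFinset_eq_degree, ← SimpleGraph.card_neighborFinset_eq_degree]
  refine (Finset.card_le_card this).trans ((Finset.card_union_le _ _).trans ?_)
  refine Nat.add_le_add ?_ le_rfl
  refine (Finset.card_union_le _ _).trans (Nat.add_le_add ?_ le_rfl)
  exact (Finset.card_union_le _ _).trans (Nat.add_le_add le_rfl le_rfl)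

theorem outDegree_le_degree (hK : K ≤ G) (v : Fin n) : K.outDegree l W v ≤ G.degree v := by
  rw [← SimpleGraph.card_neighborFinset_eq_degree]
  refine Finset.card_le_card fun w hw => ?_
  rw [SimpleGraph.mem_neighborFinset]
  exact hK (Finset.mem_filter.1 hw).2.1

/-- The quantity `D` bounds the degree of every node of the class, since a neighbour lies in another
class of `W`, in the same class, outside of `W`, or across an edge missing from `K`. Replacing each
degree in the activity by `D` shows that `t + 1` times the total out-degree is at most `D`; that
out-degree is also a summand of `D`, which costs one of the `t + 1` copies. -/
theorem sum_outDegree_le (hK : K ≤ G) (c : Fin n) (hc : (t + 1) * activity G K l W c ≤ 1) :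
    t * ∑ v ∈ W.filter (l · = c), K.outDegree l W v ≤
      ∑ v ∈ W.filter (l · = c), (1 + (G \ K).degree v)
      + ∑ v ∈ W.filter (l · = c), (Wᶜ.filter fun u => K.Adj v u).card := by
  set S := W.filter (l · = c) with hS
  set D := ∑ v ∈ S, K.outDegree l W v + S.card
    + ∑ v ∈ S, (Wᶜ.filter fun u => K.Adj v u).card + ∑ v ∈ S, (G \ K).degree v with hD
  have hdeg : ∀ v ∈ S, G.degree v ≤ D := fun v hv => by
    refine (degree_le_of_mem (K := K) c hv).trans ?_
    have h1 := Finset.single_le_sum (f := fun v => K.outDegree l W v) (fun _ _ => Nat.zero_le _) hv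
    have h2 := Finset.single_le_sum (f := fun v => (Wᶜ.filter fun u => K.Adj v u).card)
      (fun _ _ => Nat.zero_le _) hv
    have h3 := Finset.single_le_sum (f := fun v => (G \ K).degree v) (fun _ _ => Nat.zero_le _) hv
    rw [← hS]
    omega
  have hout : ∀ v ∈ S, (K.outDegree l W v : ℝ) ≤ (K.outDegree l W v : ℝ) / G.degree v * D := by
    intro v hv
    rcases Nat.eq_zero_or_pos (G.degree v) with h | h
    · have : K.outDegree l W v = 0 := by
        have := outDegree_le_degree (l := l) (W := W) hK v
        omega
      simp [this]
    · rw [div_mul_eq_mul_div, le_div_iff₀ (by exact_mod_cast h)]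
      exact_mod_cast Nat.mul_le_mul_left _ (hdeg v hv)
  have hsum : (∑ v ∈ S, (K.outDegree l W v : ℝ)) ≤ activity G K l W c * D := by
    rw [activity, Finset.sum_mul]
    exact Finset.sum_le_sum hout
  have hreal : ((t + 1) * ∑ v ∈ S, K.outDegree l W v : ℝ) ≤ D := by
    have h0 : (0 : ℝ) ≤ D := Nat.cast_nonneg _
    have h1 : (0 : ℝ) ≤ t + 1 := by positivity
    push_cast
    nlinarith [mul_le_mul_of_nonneg_left hsum h1, mul_le_mul_of_nonneg_right hc h0]
  have hnat : (t + 1) * ∑ v ∈ S, K.outDegree l W v ≤ D := by exact_mod_cast hreal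
  rw [Finset.sum_add_distrib]
  simp only [Finset.sum_const, smul_eq_mul, mul_one]
  rw [add_mul, one_mul] at hnat
  omega

/-- The pairs `N` from the removed class `S` to the remaining nodes are added to `Z`. By
`sum_outDegree_le` they are paid for by the nodes of `S` with their lost edges and by the edges `B`
from `S` to the outside. The latter are already in `Z`, directed towards `S`, and become newly
counted pairs with second node outside. Each pair pays in this way only once, when its second node
leaves `W`. -/
theorem Charged.remove_class (hK : K ≤ G) (h : Charged G K t l W) {c : Fin n}
    (hc : (t + 1) * activity G K l W c ≤ 1) : Charged G K t l (W.filter (l · ≠ c)) := by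
  have hmain := sum_outDegree_le hK c hc
  obtain ⟨Z, h1, h2, h3, h4⟩ := h
  set S := W.filter (l · = c) with hS
  set W' := W.filter (l · ≠ c) with hW'
  have memS : ∀ v, v ∈ S ↔ v ∈ W ∧ l v = c := fun v => Finset.mem_filter
  have memW' : ∀ v, v ∈ W' ↔ v ∈ W ∧ l v ≠ c := fun v => Finset.mem_filter
  set N := (S ×ˢ W').filter fun p => K.Adj p.1 p.2 with hN
  have memN : ∀ u w, (u, w) ∈ N ↔ (u ∈ S ∧ w ∈ W') ∧ K.Adj u w := fun u w => by
    rw [hN, Finset.mem_filter, Finset.mem_product]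
  have hcardN : N.card = ∑ v ∈ S, K.outDegree l W v := by
    rw [hN, card_filter_product S W' K.Adj]
    refine Finset.sum_congr rfl fun v hv => ?_
    rw [outDegree]
    congr 1
    ext w
    rw [Finset.mem_filter, Finset.mem_filter, Finset.mem_filter]
    change _ ↔ w ∈ W ∧ K.Adj v w ∧ l v ≠ l w
    rw [memS] at hv
    constructor
    · rintro ⟨⟨hw, hwc⟩, ha⟩
      exact ⟨hw, ha, fun h => hwc (h.symm.trans hv.2)⟩
    · rintro ⟨hw, ha, hl⟩
      exact ⟨⟨hw, fun h => hl (hv.2.trans h.symm)⟩, ha⟩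
  set B := (S ×ˢ Wᶜ).filter fun p => K.Adj p.1 p.2 with hB
  have hcardB : B.card = ∑ v ∈ S, (Wᶜ.filter fun u => K.Adj v u).card :=
    card_filter_product S Wᶜ K.Adj
  have hcompl : W'ᶜ = Wᶜ ∪ S := by
    ext v
    simp only [Finset.mem_compl, Finset.mem_union, memS, memW']
    tauto
  have hdisj : Disjoint Wᶜ S := by
    rw [Finset.disjoint_left]
    intro v hv hv'
    exact (Finset.mem_compl.1 hv) ((memS v).1 hv').1
  refine ⟨Z ∪ N, ?_, ?_, ?_, ?_⟩
  · rintro ⟨u, w⟩ hp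
    rw [memW']
    rcases Finset.mem_union.1 hp with hp | hp
    · exact fun h => h1 _ hp h.1
    · exact fun h => h.2 ((memS u).1 ((memN u w).1 hp).1.1).2
  · intro u hu w hw ha
    rw [Finset.mem_union]
    by_cases huW : u ∈ W
    · right
      rw [memN]
      refine ⟨⟨(memS u).2 ⟨huW, ?_⟩, hw⟩, ha⟩
      by_contra hne
      exact hu ((memW' u).2 ⟨huW, hne⟩)
    · exact Or.inl (h2 u huW w ((memW' w).1 hw).1 ha)
  · intro u hu w hw ha
    have cls : ∀ x, x ∉ W' → x ∈ W → l x = c := fun x hx hxW => by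
      by_contra hne
      exact hx ((memW' x).2 ⟨hxW, hne⟩)
    rw [Finset.mem_union, Finset.mem_union]
    by_cases huW : u ∈ W <;> by_cases hwW : w ∈ W
    · exact absurd ((cls u hu huW).trans (cls w hw hwW).symm) ha.2
    · exact Or.inr (Or.inl (h2 w hwW u huW ha.1.symm))
    · exact Or.inl (Or.inl (h2 u huW w hwW ha.1))
    · rcases h3 u huW w hwW ha with h | h
      · exact Or.inl (Or.inl h)
      · exact Or.inr (Or.inl h)
  · have hsub : (Z.filter fun p => p.2 ∉ W) ∪ B.image Prod.swap ⊆
        (Z ∪ N).filter fun p => p.2 ∉ W' := by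
      rintro ⟨u, w⟩ hp
      rw [Finset.mem_filter, Finset.mem_union, memW']
      rcases Finset.mem_union.1 hp with hp | hp
      · rw [Finset.mem_filter] at hp
        exact ⟨Or.inl hp.1, fun h => hp.2 h.1⟩
      · obtain ⟨⟨w', u'⟩, hq, heq⟩ := Finset.mem_image.1 hp
        simp only [Prod.swap_prod_mk, Prod.mk.injEq] at heq
        obtain ⟨rfl, rfl⟩ := heq
        rw [hB, Finset.mem_filter, Finset.mem_product, memS, Finset.mem_compl] at hq
        exact ⟨Or.inl (h2 _ hq.1.2 _ hq.1.1.1 hq.2.symm), fun h => h.2 hq.1.1.2⟩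
    have hdis : Disjoint (Z.filter fun p => p.2 ∉ W) (B.image Prod.swap) := by
      rw [Finset.disjoint_left]
      rintro ⟨u, w⟩ hp hp'
      obtain ⟨⟨w', u'⟩, hq, heq⟩ := Finset.mem_image.1 hp'
      simp only [Prod.swap_prod_mk, Prod.mk.injEq] at heq
      obtain ⟨rfl, rfl⟩ := heq
      rw [hB, Finset.mem_filter, Finset.mem_product, memS] at hq
      exact (Finset.mem_filter.1 hp).2 hq.1.1.1
    have hcard := Finset.card_le_card hsub
    rw [Finset.card_union_of_disjoint hdis,
      Finset.card_image_of_injective _ Prod.swap_injective, hcardB] at hcard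
    have hun := Nat.mul_le_mul_left t (Finset.card_union_le Z N)
    rw [mul_add, hcardN] at hun
    rw [hcompl, Finset.sum_union hdisj]
    omega

/-- Removing one inactive class may make another inactive, hence the induction on the size of `W`.
-/
theorem Charged.exists_active (hK : K ≤ G) (h : Charged G K t l W) :
    ∃ W' ⊆ W, Charged G K t l W' ∧ ∀ c ∈ W'.image l, 1 < (t + 1) * activity G K l W' c := by
  induction hm : W.card using Nat.strong_induction_on generalizing W with
  | _ m ih =>
    subst hm
    by_cases hact : ∀ c ∈ W.image l, 1 < (t + 1) * activity G K l W c
    · exact ⟨W, subset_rfl, h, hact⟩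
    · push Not at hact
      obtain ⟨c, hc, hle⟩ := hact
      obtain ⟨v, hv, hvc⟩ := Finset.mem_image.1 hc
      have hss : W.filter (l · ≠ c) ⊂ W := Finset.filter_ssubset.2 ⟨v, hv, by simpa using hvc⟩
      obtain ⟨W', h1, h2⟩ := ih _ (Finset.card_lt_card hss) (h.remove_class hK hle) rfl
      exact ⟨W', h1.trans hss.subset, h2⟩

/-- With `W` empty, every pair of `Z` has its second node outside, so the last term of the charging
inequality is at most `Z.card` and absorbs one of the `t + 1` copies. -/
theorem Charged.card_cross_le (h : Charged G K (t + 1) l ∅) :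
    t * (K.cross l).edgeFinset.card ≤ n + 2 * (G \ K).edgeFinset.card := by
  obtain ⟨Z, -, -, h3, h4⟩ := h
  have hsub : (K.cross l).edgeFinset ⊆ Z.image fun p => s(p.1, p.2) := by
    intro e he
    induction e using Sym2.ind with
    | _ u w =>
      rw [mem_edgeFinset, mem_edgeSet] at he
      rw [Finset.mem_image]
      rcases h3 u (by simp) w (by simp) he with h | h
      · exact ⟨_, h, rfl⟩
      · exact ⟨_, h, Sym2.eq_swap⟩
  have hle := (Finset.card_le_card hsub).trans Finset.card_image_le
  have hfil : (Z.filter fun p => p.2 ∉ (∅ : Finset (Fin n))).card ≤ Z.card :=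
    Finset.card_filter_le _ _
  have hdeg : ∑ u, (G \ K).degree u = 2 * (G \ K).edgeFinset.card := by
    rw [sum_degrees_eq_twice_card_edges]
    congr!
  rw [Finset.compl_empty, Finset.sum_add_distrib, hdeg] at h4
  simp only [Finset.sum_const, smul_eq_mul, mul_one, Finset.card_univ, Fintype.card_fin] at h4
  have := Nat.mul_le_mul_left t hle
  rw [add_mul, one_mul] at h4
  omega

theorem sum_activity (l : Fin n → Fin n) (W : Finset (Fin n)) :
    ∑ c ∈ W.image l, activity G K l W c = ∑ v ∈ W, (K.outDegree l W v : ℝ) / G.degree v :=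
  Finset.sum_fiberwise_of_maps_to (fun _ hv => Finset.mem_image_of_mem _ hv) _

/-- The sum on the right is `n` times the probability that a sample crosses between classes inside
`W`; each active class contributes more than `1 / s` to it. -/
theorem card_image_le_of_active {s : ℝ} (hact : ∀ c ∈ W.image l, 1 < s * activity G K l W c) :
    ((W.image l).card : ℝ) ≤ s * ∑ v ∈ W, (K.outDegree l W v : ℝ) / G.degree v := by
  rw [← sum_activity, Finset.mul_sum]
  have := Finset.sum_le_sum fun c hc => (hact c hc).le
  simpa using this

/-- Give the nodes with label `p` the label `q`. -/
def relabel (l : Fin n → Fin n) (p q : Fin n) : Fin n → Fin n := fun x => if l x = p then q else l x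

theorem relabel_eq_of_eq (p q : Fin n) {u v : Fin n} (h : l u = l v) :
    relabel l p q u = relabel l p q v := by
  simp only [relabel, h]

theorem card_image_le_of_refines (hl : ∀ u v, l u = l v → l' u = l' v) (W : Finset (Fin n)) :
    (W.image l').card ≤ (W.image l).card := by
  refine Finset.card_le_card_of_surjOn (fun c => if h : ∃ v ∈ W, l v = c then l' h.choose else c) ?_
  intro c hc
  obtain ⟨v, hv, rfl⟩ := Finset.mem_image.1 (Finset.mem_coe.1 hc)
  refine ⟨l v, Finset.mem_coe.2 (Finset.mem_image_of_mem _ hv), ?_⟩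
  have h : ∃ w ∈ W, l w = l v := ⟨v, hv, rfl⟩
  simp only [h, dif_pos]
  exact hl _ _ h.choose_spec.2

theorem card_image_relabel {u v : Fin n} (hu : u ∈ W) (hv : v ∈ W) (h : l u ≠ l v) :
    (W.image (relabel l (l u) (l v))).card + 1 ≤ (W.image l).card := by
  have hsub : W.image (relabel l (l u) (l v)) ⊆ (W.image l).erase (l u) := by
    intro c hc
    obtain ⟨w, hw, rfl⟩ := Finset.mem_image.1 hc
    simp only [relabel]
    split_ifs with hwu
    · exact Finset.mem_erase.2 ⟨h.symm, Finset.mem_image_of_mem _ hv⟩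
    · exact Finset.mem_erase.2 ⟨hwu, Finset.mem_image_of_mem _ hw⟩
  have h1 := Finset.card_le_card hsub
  have h2 := Finset.card_erase_add_one (Finset.mem_image_of_mem l hu)
  omega

end SimpleGraph

/-! ### Levels of forests and the certificate they define. -/

/-- Edge-disjoint forests `forest 0`, `forest 1`, … of a graph, and for each of them labels of the
nodes which tell the connected components of the forest. -/
structure Levels (n : ℕ) where
  lab : ℕ → Fin n → Fin n
  forest : ℕ → Finset (Sym2 (Fin n))

namespace Levels

open scoped Classical
open SimpleGraph

variable {n : ℕ} (G : SimpleGraph (Fin n))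

/-- The edges of `G` that neither belong to the first `i` forests nor connect different components
of one of them. -/
def rest (a : Levels n) (i : ℕ) : SimpleGraph (Fin n) where
  Adj u v := G.Adj u v ∧ ∀ j < i, s(u, v) ∉ a.forest j ∧ a.lab j u = a.lab j v
  symm := ⟨fun u v h => ⟨h.1.symm, fun j hj => by
    rw [Sym2.eq_swap]; exact ⟨(h.2 j hj).1, (h.2 j hj).2.symm⟩⟩⟩
  loopless := ⟨fun u h => G.loopless.irrefl u h.1⟩

/-- The edges between different components of forest `j` that appear at level `j`. -/
noncomputable def crossing (a : Levels n) (j : ℕ) : Finset (Sym2 (Fin n)) :=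
  ((a.rest G j).cross (a.lab j)).edgeFinset

/-- The number of nodes with label `c`. -/
noncomputable def classSize (l : Fin n → Fin n) (c : Fin n) : ℕ :=
  (Finset.univ.filter fun x => l x = c).card

/-- The labels after the smaller one of the classes of `v` and `w` got the label of the other. -/
noncomputable def join (l : Fin n → Fin n) (v w : Fin n) : Fin n → Fin n :=
  if classSize l (l v) < classSize l (l w) then relabel l (l v) (l w) else relabel l (l w) (l v)

/-- Add the edge `vw` to forest `i` if it connects different components and belongs to the graph
which that forest is to span. -/
noncomputable def step (i : ℕ) (v w : Fin n) (a : Levels n) : Levels n :=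
  if ((a.rest G i).cross (a.lab i)).Adj v w then
    { lab := Function.update a.lab i (join (a.lab i) v w)
      forest := Function.update a.forest i (insert s(v, w) (a.forest i)) }
  else a

/-- Acyclicity enters only through the count `card_le`. By `lab_eq`, an edge of a forest does not
cross at that level or at any earlier one. -/
structure Valid (k : ℕ) (a : Levels n) : Prop where
  mem_edgeSet : ∀ j, ∀ e ∈ a.forest j, e ∈ G.edgeSet
  notMem : ∀ j j', j ≠ j' → ∀ e ∈ a.forest j, e ∉ a.forest j'
  lab_eq : ∀ j u v, s(u, v) ∈ a.forest j → ∀ j' ≤ j, a.lab j' u = a.lab j' v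
  reachable : ∀ j u v, a.lab j u = a.lab j v →
    (fromEdgeSet (a.forest j : Set (Sym2 (Fin n)))).Reachable u v
  card_le : ∀ j, (a.forest j).card + (Finset.univ.image (a.lab j)).card ≤ n
  forest_eq_empty : ∀ j, k ≤ j → a.forest j = ∅

/-- At the first `m` levels, few edges lead from one component to another. -/
def Sparse (e m : ℕ) (a : Levels n) : Prop := ∀ j < m, e * (a.crossing G j).card ≤ n

variable {G} {a : Levels n} {i k e : ℕ} {v w : Fin n}

theorem join_eq_of_eq {l : Fin n → Fin n} (v w : Fin n) {x y : Fin n} (h : l x = l y) :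
    join l v w x = join l v w y := by
  unfold join
  split_ifs <;> exact relabel_eq_of_eq _ _ h

theorem card_image_join {l : Fin n → Fin n} {W : Finset (Fin n)} (hv : v ∈ W) (hw : w ∈ W)
    (h : l v ≠ l w) : (W.image (join l v w)).card + 1 ≤ (W.image l).card := by
  unfold join
  split_ifs
  · exact card_image_relabel hv hw h
  · exact card_image_relabel hw hv h.symm

theorem join_self {l : Fin n → Fin n} : join l v w v = join l v w w := by
  unfold join relabel
  split_ifs <;> simp_all

theorem eq_of_join_eq {l : Fin n → Fin n} {x y : Fin n} (h : join l v w x = join l v w y) :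
    l x = l y ∨ (l x = l v ∧ l y = l w) ∨ (l x = l w ∧ l y = l v) := by
  unfold join at h
  split_ifs at h <;> unfold relabel at h <;> split_ifs at h <;> simp_all

theorem rest_congr {a b : Levels n} (hl : ∀ j < i, a.lab j = b.lab j)
    (hf : ∀ j < i, a.forest j = b.forest j) : a.rest G i = b.rest G i := by
  ext u v
  refine and_congr_right fun _ => forall₂_congr fun j hj => ?_
  rw [hl j hj, hf j hj]

/-- The graph that level `i` works in depends on earlier levels only, so it stays fixed while that
level is built. -/
theorem rest_step {j : ℕ} (hj : j ≤ i) : (a.step G i v w).rest G j = a.rest G j := by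
  unfold step
  split_ifs
  · exact rest_congr (fun j' hj' => Function.update_of_ne (by omega) _ _)
      (fun j' hj' => Function.update_of_ne (by omega) _ _)
  · rfl

theorem lab_step_of_ne {j : ℕ} (hj : j ≠ i) : (a.step G i v w).lab j = a.lab j := by
  unfold step
  split_ifs
  · exact Function.update_of_ne hj _ _
  · rfl

theorem lab_step_eq_of_eq {j : ℕ} {x y : Fin n} (h : a.lab j x = a.lab j y) :
    (a.step G i v w).lab j x = (a.step G i v w).lab j y := by
  by_cases hj : j = i
  · subst hj
    unfold step
    split_ifs
    · simpa using join_eq_of_eq v w h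
    · exact h
  · rwa [lab_step_of_ne hj]

theorem crossing_step {j : ℕ} (hj : j < i) : (a.step G i v w).crossing G j = a.crossing G j := by
  unfold crossing
  congr! 2
  · exact rest_step hj.le
  · exact lab_step_of_ne hj.ne

theorem Sparse.step (h : Sparse G e i a) (v w : Fin n) : Sparse G e i (a.step G i v w) :=
  fun j hj => by rw [crossing_step hj]; exact h j hj

theorem Valid.step (h : Valid G k a) (hi : i < k) (v w : Fin n) : Valid G k (a.step G i v w) := by
  have hlab : ∀ j x y, a.lab j x = a.lab j y →
      (a.step G i v w).lab j x = (a.step G i v w).lab j y := fun j x y hxy => lab_step_eq_of_eq hxy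
  by_cases hc : ((a.rest G i).cross (a.lab i)).Adj v w
  swap
  · rwa [Levels.step, if_neg hc]
  have hmem : ∀ j e, e ∈ (a.step G i v w).forest j → e ∈ a.forest j ∨ (j = i ∧ e = s(v, w)) := by
    intro j e he
    rw [Levels.step, if_pos hc] at he
    by_cases hj : j = i
    · subst hj
      simp only [Function.update_self, Finset.mem_insert] at he
      tauto
    · left
      simpa [hj] using he
  -- Earlier forests are excluded by `rest`; membership in forest `i` or a later one would give the
  -- ends equal labels at level `i`.
  have hnew : ∀ j, s(v, w) ∉ a.forest j := fun j hj => by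
    by_cases hji : j < i
    · exact (hc.1.2 j hji).1 hj
    · exact hc.2 (h.lab_eq j v w hj i (by omega))
  have hself : (a.step G i v w).lab i v = (a.step G i v w).lab i w := by
    rw [Levels.step, if_pos hc]
    simpa using join_self
  constructor
  · intro j e he
    rcases hmem j e he with he | ⟨-, rfl⟩
    · exact h.mem_edgeSet j e he
    · exact hc.1.1
  · intro j j' hne e he he'
    rcases hmem j e he with h1 | ⟨rfl, rfl⟩ <;> rcases hmem j' _ he' with h2 | ⟨rfl, h2⟩
    · exact h.notMem j j' hne e h1 h2
    · exact hnew j (h2 ▸ h1)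
    · exact hnew j' h2
    · exact hne rfl
  · intro j x y he j' hj'
    rcases hmem j _ he with h1 | ⟨rfl, h1⟩
    · exact hlab _ _ _ (h.lab_eq j x y h1 j' hj')
    · have key : (a.step G j v w).lab j' v = (a.step G j v w).lab j' w := by
        rcases hj'.lt_or_eq with hlt | rfl
        · exact hlab _ _ _ (hc.1.2 j' hlt).2
        · exact hself
      rcases Sym2.eq_iff.1 h1 with ⟨rfl, rfl⟩ | ⟨rfl, rfl⟩
      · exact key
      · exact key.symm
  · intro j x y hxy
    by_cases hj : j = i
    · subst hj
      rw [Levels.step, if_pos hc] at hxy ⊢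
      simp only [Function.update_self] at hxy ⊢
      have hmono : fromEdgeSet (a.forest j : Set (Sym2 (Fin n))) ≤
          fromEdgeSet ((insert s(v, w) (a.forest j) : Finset _) : Set (Sym2 (Fin n))) :=
        fromEdgeSet_mono (by simp)
      have hold : ∀ x y, a.lab j x = a.lab j y →
          (fromEdgeSet ((insert s(v, w) (a.forest j) : Finset _) : Set (Sym2 (Fin n)))).Reachable
            x y := fun x y hxy => (h.reachable j x y hxy).mono hmono
      have hvw : (fromEdgeSet ((insert s(v, w) (a.forest j) : Finset _) :
          Set (Sym2 (Fin n)))).Adj v w := by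
        rw [fromEdgeSet_adj]
        exact ⟨by simp, hc.1.1.ne⟩
      rcases eq_of_join_eq hxy with h1 | ⟨h1, h2⟩ | ⟨h1, h2⟩
      · exact hold _ _ h1
      · exact ((hold _ _ h1).trans hvw.reachable).trans (hold _ _ h2.symm)
      · exact ((hold _ _ h1).trans hvw.symm.reachable).trans (hold _ _ h2.symm)
    · rw [Levels.step, if_pos hc] at hxy ⊢
      simp only [Function.update_of_ne hj] at hxy ⊢
      exact h.reachable j x y hxy
  · intro j
    rw [Levels.step, if_pos hc]
    by_cases hj : j = i
    · subst hj
      simp only [Function.update_self]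
      rw [Finset.card_insert_of_notMem (hnew j)]
      have := card_image_join (Finset.mem_univ v) (Finset.mem_univ w) hc.2
      have := h.card_le j
      omega
    · simp only [Function.update_of_ne hj]
      exact h.card_le j
  · intro j hj
    rw [Levels.step, if_pos hc]
    simp only [Function.update_of_ne (show j ≠ i by omega)]
    exact h.forest_eq_empty j hj

/-- Before the first step, every node is a component of its own. -/
def start (n : ℕ) : Levels n := ⟨fun _ v => v, fun _ => ∅⟩

theorem valid_start : Valid G k (start n) where
  mem_edgeSet := by simp [start]
  notMem := by simp [start]
  lab_eq := by simp [start]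
  reachable := by
    rintro j u v (rfl : u = v)
    exact Reachable.refl _
  card_le := by simp [start]
  forest_eq_empty := by simp [start]

/-- An edge lost between `rest G m` and `rest G (m + 1)` is in forest `m` or crosses between its
components. -/
theorem card_sdiff_rest_le (a : Levels n) (m : ℕ) : (G \ a.rest G m).edgeFinset.card ≤
    ∑ j ∈ Finset.range m, ((a.forest j).card + (a.crossing G j).card) := by
  induction m with
  | zero =>
    have h0 : G \ a.rest G 0 = ⊥ := by
      ext u v
      simp [rest]
    rw [Finset.range_zero, Finset.sum_empty, Nat.le_zero, Finset.card_eq_zero]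
    ext e
    rw [mem_edgeFinset, h0]
    simp
  | succ m ih =>
    rw [Finset.sum_range_succ]
    have hsub : (G \ a.rest G (m + 1)).edgeFinset ⊆
        (G \ a.rest G m).edgeFinset ∪ (a.forest m ∪ a.crossing G m) := by
      intro e he
      induction e using Sym2.ind with
      | _ u v =>
        simp only [Finset.mem_union, mem_edgeFinset, SimpleGraph.mem_edgeSet, sdiff_adj,
          crossing] at he ⊢
        by_contra! hne
        obtain ⟨h1, h2, h3⟩ := hne
        have hr := h1 he.1
        refine he.2 ⟨he.1, fun j hj => ?_⟩
        rcases (Nat.lt_succ_iff.1 hj).lt_or_eq with hlt | rfl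
        · exact hr.2 j hlt
        · refine ⟨h2, ?_⟩
          by_contra hl
          exact h3 ⟨hr, hl⟩
    refine (Finset.card_le_card hsub).trans ((Finset.card_union_le _ _).trans ?_)
    exact Nat.add_le_add ih (Finset.card_union_le _ _)

theorem Valid.card_forest_lt (h : Valid G k a) (hn : 0 < n) (j : ℕ) :
    (a.forest j).card + 1 ≤ n := by
  have h1 := h.card_le j
  have h2 : 0 < (Finset.univ.image (a.lab j)).card :=
    Finset.card_pos.2 ⟨_, Finset.mem_image_of_mem _ (Finset.mem_univ ⟨0, hn⟩)⟩
  omega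

/-- At most `2 * n` edges were lost at each of the `j` earlier levels, so the charging gives `4 * k
* e * crossing ≤ n + 4 * j * n ≤ 4 * k * n`. This is where the factor `4 * k * e` comes from. -/
theorem Sparse.succ_of_charged (hv : Valid G k a) (hs : Sparse G e i a) (hi : i < k) (he : 1 ≤ e)
    (h : Charged G (a.rest G i) (4 * k * e + 1) (a.lab i) ∅) : Sparse G e (i + 1) a := by
  intro j hj
  rcases (Nat.lt_succ_iff.1 hj).lt_or_eq with hlt | rfl
  · exact hs j hlt
  have h1 : 4 * k * e * (a.crossing G j).card ≤ n + 2 * (G \ a.rest G j).edgeFinset.card :=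
    h.card_cross_le
  have h2 := card_sdiff_rest_le (G := G) a j
  have h3 : ∑ j' ∈ Finset.range j, ((a.forest j').card + (a.crossing G j').card) ≤
      ∑ j' ∈ Finset.range j, 2 * n := by
    refine Finset.sum_le_sum fun j' hj' => ?_
    have := hs j' (Finset.mem_range.1 hj')
    have := hv.card_le j'
    have := Nat.le_mul_of_pos_left (a.crossing G j').card he
    omega
  rw [Finset.sum_const, Finset.card_range, smul_eq_mul] at h3
  have h4 : (j + 1) * n ≤ k * n := Nat.mul_le_mul_right n hi
  have h5 : (4 * k) * (e * (a.crossing G j).card) ≤ (4 * k) * n := by nlinarith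
  exact Nat.le_of_mul_le_mul_left h5 (by omega)

/-! ### The certificate -/

/-- The edges of the certificate: those that are not left over after `k` levels. -/
theorem isConnectivityCertificate (h : Valid G k a) :
    IsConnectivityCertificate G (G \ a.rest G k) k := by
  refine ⟨sdiff_le, fun F hF hcard u v => ⟨fun huv => ?_, fun huv => ?_⟩⟩
  swap
  · exact huv.mono (deleteEdges_mono sdiff_le)
  have hadj : ∀ x y, (G.deleteEdges (F : Set (Sym2 (Fin n)))).Adj x y →
      ((G \ a.rest G k).deleteEdges (F : Set (Sym2 (Fin n)))).Reachable x y := by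
    intro x y hxy
    rw [deleteEdges_adj] at hxy
    by_cases hr : (a.rest G k).Adj x y
    swap
    · refine Adj.reachable ?_
      rw [deleteEdges_adj]
      exact ⟨⟨hxy.1, hr⟩, hxy.2⟩
    -- If `F` met all `k` disjoint forests, it would have `k` elements.
    obtain ⟨j, hj, hdis⟩ : ∃ j < k, ∀ e ∈ a.forest j, e ∉ F := by
      by_contra! hne
      have : Nonempty (Sym2 (Fin n)) := ⟨s(x, y)⟩
      choose! f hf hf' using hne
      have := Finset.card_le_card_of_injOn (s := Finset.range k) (t := F) f
        (fun j hj => hf' j (Finset.mem_range.1 hj)) (by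
          intro j hj j' hj' heq
          by_contra hjj
          have h1 := hf j (Finset.mem_range.1 hj)
          have h2 := hf j' (Finset.mem_range.1 hj')
          exact h.notMem j j' hjj _ h1 (heq ▸ h2))
      rw [Finset.card_range] at this
      omega
    refine (h.reachable j x y (hr.2 j hj).2).mono ?_
    intro p q hpq
    rw [fromEdgeSet_adj] at hpq
    rw [deleteEdges_adj]
    -- Forest edges are absent from `rest G k` by its definition, so they belong to the certificate.
    exact ⟨⟨h.mem_edgeSet j _ hpq.1, fun hr' => (hr'.2 j hj).1 hpq.1⟩, hdis _ hpq.1⟩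
  obtain ⟨p⟩ := huv
  induction p with
  | nil => exact Reachable.refl _
  | cons hxy _ ih => exact (hadj _ _ hxy).trans ih

theorem card_edgeFinset_le {ε : ℝ} (h : Valid G k a) (hn : 0 < n) (hε : 0 < ε)
    (hs : Sparse G (min ⌈1 / ε⌉₊ n) k a) :
    ((G \ a.rest G k).edgeSet.ncard : ℝ) ≤ (1 + ε) * k * n := by
  have hn' : (0 : ℝ) < n := by exact_mod_cast hn
  have key : ∀ j < k, (((a.forest j).card + (a.crossing G j).card : ℕ) : ℝ) ≤ (1 + ε) * n := by
    intro j hj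
    have h1 : ((a.forest j).card : ℝ) + 1 ≤ n := by exact_mod_cast h.card_forest_lt hn j
    have h2 := hs j hj
    push_cast
    rcases min_cases ⌈1 / ε⌉₊ n with ⟨hm, -⟩ | ⟨hm, -⟩
    · rw [hm] at h2
      have h3 : (⌈1 / ε⌉₊ : ℝ) * ((a.crossing G j).card : ℝ) ≤ n := by exact_mod_cast h2
      have h4 : 1 / ε * ((a.crossing G j).card : ℝ) ≤ n :=
        (mul_le_mul_of_nonneg_right (Nat.le_ceil _) (Nat.cast_nonneg _)).trans h3
      rw [div_mul_eq_mul_div, one_mul, div_le_iff₀ hε] at h4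
      linarith
    -- When the cap `n` applies, at most one edge crosses, and it is compensated by the forest
    -- having at most `n - 1` edges; no multiple of `ε` is needed.
    · rw [hm] at h2
      have h3 : (a.crossing G j).card ≤ 1 := Nat.le_of_mul_le_mul_left (by simpa using h2) hn
      have h4 : ((a.crossing G j).card : ℝ) ≤ 1 := by exact_mod_cast h3
      nlinarith [mul_pos hε hn']
  have h1 : (G \ a.rest G k).edgeSet.ncard = (G \ a.rest G k).edgeFinset.card := by
    rw [← coe_edgeFinset, Set.ncard_coe_finset]
  rw [h1]
  calc ((G \ a.rest G k).edgeFinset.card : ℝ)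
      ≤ ((∑ j ∈ Finset.range k, ((a.forest j).card + (a.crossing G j).card) : ℕ) : ℝ) := by
        exact_mod_cast card_sdiff_rest_le (G := G) a k
    _ ≤ ∑ j ∈ Finset.range k, (1 + ε) * n := by
        rw [Nat.cast_sum]
        exact Finset.sum_le_sum fun j hj => key j (Finset.mem_range.1 hj)
    _ = (1 + ε) * k * n := by
        rw [Finset.sum_const, Finset.card_range, nsmul_eq_mul]
        ring

end Levels

/-! ### Random sampling at one level and its rate of convergence. -/

namespace Levels

open scoped Classical
open SimpleGraph

variable {n : ℕ} {G : SimpleGraph (Fin n)} (L : AdjList G)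

/-- The expected value of `φ` after the step at level `i` with a random edge at a random node. -/
noncomputable def sample (i : ℕ) (φ : Levels n → ℝ≥0∞) (a : Levels n) : ℝ≥0∞ :=
  (n : ℝ≥0∞)⁻¹ * ∑ v : Fin n, (((L.nbrs v).length - 1 + 1 : ℕ) : ℝ≥0∞)⁻¹ *
    ∑ x : Fin ((L.nbrs v).length - 1 + 1), φ ((L.nbrs v)[(x : ℕ)]?.elim a (a.step G i v))

theorem inv_mul_sum_ofReal {ι : Type*} (s : Finset ι) (m : ℕ) (f : ι → ℝ) (hm : 0 < m)
    (hf : ∀ i ∈ s, 0 ≤ f i) :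
    (m : ℝ≥0∞)⁻¹ * ∑ i ∈ s, ENNReal.ofReal (f i) = ENNReal.ofReal ((∑ i ∈ s, f i) / m) := by
  rw [← ENNReal.ofReal_sum_of_nonneg hf, ENNReal.ofReal_div_of_pos (by exact_mod_cast hm),
    ENNReal.ofReal_natCast, ENNReal.div_eq_inv_mul]

theorem length_nbrs (v : Fin n) : (L.nbrs v).length = G.degree v := by
  rw [← List.toFinset_card_of_nodup (L.nodup v), ← card_neighborFinset_eq_degree]
  congr 1
  ext w
  simp [L.mem_nbrs]

theorem sum_getElem?_nbrs {m : ℕ} (v : Fin n) (hm : m = (L.nbrs v).length)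
    (f : Option (Fin n) → ℝ≥0∞) :
    ∑ x : Fin m, f (L.nbrs v)[(x : ℕ)]? = ∑ w ∈ G.neighborFinset v, f (some w) := by
  subst hm
  have h1 : G.neighborFinset v = (L.nbrs v).toFinset := by
    ext w
    simp [L.mem_nbrs]
  rw [h1, List.sum_toFinset _ (L.nodup v), ← Fin.sum_univ_fun_getElem]
  simp

variable {K : SimpleGraph (Fin n)} {a : Levels n} {i k : ℕ} {φ : Levels n → ℝ≥0∞}
  {l : Fin n → Fin n} {W : Finset (Fin n)} {b c : ℝ}

theorem average_nbrs_le (hK : K ≤ G) (hb : 0 ≤ b)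
    (hcb : ∀ v ∈ W, ∀ w ∈ W, (K.cross l).Adj v w → c ≤ b) (h0 : φ a ≤ ENNReal.ofReal b)
    (h : ∀ v w, φ (a.step G i v w) ≤
      ENNReal.ofReal (b - if v ∈ W ∧ w ∈ W ∧ (K.cross l).Adj v w then c else 0)) (v : Fin n) :
    (((L.nbrs v).length - 1 + 1 : ℕ) : ℝ≥0∞)⁻¹ *
      ∑ x : Fin ((L.nbrs v).length - 1 + 1), φ ((L.nbrs v)[(x : ℕ)]?.elim a (a.step G i v)) ≤
    ENNReal.ofReal (b - if v ∈ W then c * ((K.outDegree l W v : ℝ) / G.degree v) else 0) := by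
  rcases Nat.eq_zero_or_pos (L.nbrs v).length with hd | hd
  -- An isolated node makes an empty draw that changes nothing, and its quotient is `0 / 0 = 0`.
  · have hz : L.nbrs v = [] := List.length_eq_zero_iff.1 hd
    have hdeg : G.degree v = 0 := by rw [← length_nbrs L, hd]
    simpa [hz, hdeg] using h0
  · have hd' : (L.nbrs v).length - 1 + 1 = (L.nbrs v).length := Nat.sub_add_cancel hd
    rw [sum_getElem?_nbrs L v hd' fun o => φ (o.elim a (a.step G i v)), hd', length_nbrs L]
    rw [length_nbrs L] at hd
    have hnn : ∀ w, 0 ≤ b - if v ∈ W ∧ w ∈ W ∧ (K.cross l).Adj v w then c else 0 := fun w => by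
      split_ifs with hw
      · exact sub_nonneg.2 (hcb v hw.1 w hw.2.1 hw.2.2)
      · simpa using hb
    have hsum : ∑ w ∈ G.neighborFinset v, φ ((some w).elim a (a.step G i v)) ≤
        ∑ w ∈ G.neighborFinset v,
          ENNReal.ofReal (b - if v ∈ W ∧ w ∈ W ∧ (K.cross l).Adj v w then c else 0) :=
      Finset.sum_le_sum fun w _ => h v w
    refine (mul_le_mul_right hsum _).trans ?_
    rw [inv_mul_sum_ofReal _ _ _ hd fun w _ => hnn w]
    refine ENNReal.ofReal_le_ofReal (le_of_eq ?_)
    have hdR : (G.degree v : ℝ) ≠ 0 := by exact_mod_cast hd.ne'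
    rw [Finset.sum_sub_distrib, Finset.sum_const, card_neighborFinset_eq_degree, nsmul_eq_mul,
      sub_div, mul_div_cancel_left₀ _ hdR]
    congr 1
    by_cases hv : v ∈ W
    · simp only [hv, true_and, if_true]
      rw [← Finset.sum_filter, Finset.sum_const, nsmul_eq_mul, outDegree]
      have : (G.neighborFinset v).filter (fun w => w ∈ W ∧ (K.cross l).Adj v w) =
          W.filter fun w => (K.cross l).Adj v w := by
        ext w
        simp only [Finset.mem_filter, mem_neighborFinset]
        exact ⟨fun hw => hw.2, fun hw => ⟨hK hw.2.1, hw⟩⟩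
      rw [this]
      ring
    · simp [hv]

/-- A gain `c` for samples that cross between classes inside `W` becomes, on average, `c` times the
probability of such a sample. -/
theorem sample_le (hn : 0 < n) (hK : K ≤ G) (hb : 0 ≤ b) (hc : 0 ≤ c)
    (hcb : ∀ v ∈ W, ∀ w ∈ W, (K.cross l).Adj v w → c ≤ b) (h0 : φ a ≤ ENNReal.ofReal b)
    (h : ∀ v w, φ (a.step G i v w) ≤
      ENNReal.ofReal (b - if v ∈ W ∧ w ∈ W ∧ (K.cross l).Adj v w then c else 0)) :
    sample L i φ a ≤
      ENNReal.ofReal (b - c / n * ∑ v ∈ W, (K.outDegree l W v : ℝ) / G.degree v) := by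
  have hnn : ∀ v, 0 ≤ b - if v ∈ W then c * ((K.outDegree l W v : ℝ) / G.degree v) else 0 := by
    intro v
    split_ifs with hv
    · rcases Nat.eq_zero_or_pos (K.outDegree l W v) with h1 | h1
      · simpa [h1] using hb
      · obtain ⟨w, hw⟩ := Finset.card_pos.1 h1
        rw [Finset.mem_filter] at hw
        have h2 : (K.outDegree l W v : ℝ) / G.degree v ≤ 1 :=
          div_le_one_of_le₀ (by exact_mod_cast outDegree_le_degree hK v) (Nat.cast_nonneg _)
        nlinarith [hcb v hv w hw.1 hw.2]
    · simpa using hb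
  have hsum := Finset.sum_le_sum fun v (_ : v ∈ Finset.univ) =>
    average_nbrs_le L hK hb hcb h0 h v
  refine (mul_le_mul_right hsum _).trans ?_
  rw [inv_mul_sum_ofReal _ _ _ hn fun v _ => hnn v]
  refine ENNReal.ofReal_le_ofReal (le_of_eq ?_)
  have hnR : (n : ℝ) ≠ 0 := by exact_mod_cast hn.ne'
  rw [Finset.sum_sub_distrib, Finset.sum_const, Finset.card_univ, Fintype.card_fin, nsmul_eq_mul,
    sub_div, mul_div_cancel_left₀ _ hnR, ← Finset.sum_filter, ← Finset.mul_sum]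
  congr 1
  rw [Finset.filter_mem_eq_inter, Finset.univ_inter]
  ring

variable {e : ℕ}

/-- The potential is the number of classes meeting `W`, which shrinks in expectation by the factor
`1 - 1 / T` per step, with `T = n * (4 * k * e + 2)`. The set `W` is adaptive: before every step
inactive classes are removed, which only lowers the potential. A nonempty `W` at the end counts at
least 1 and pays for the failure; an empty one makes the level sparse. -/
theorem sample_iterate_le (hi : i < k) (he : 1 ≤ e) (hn : 0 < n) {c₀ : ℝ} (hc₀ : 0 ≤ c₀)
    (hφ₁ : ∀ a, Valid G k a → φ a ≤ ENNReal.ofReal (c₀ + 1))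
    (hφ : ∀ a, Valid G k a → Sparse G e (i + 1) a → φ a ≤ ENNReal.ofReal c₀)
    (z : ℕ) : ∀ (a : Levels n) (W : Finset (Fin n)), Valid G k a → Sparse G e i a →
      Charged G (a.rest G i) (4 * k * e + 1) (a.lab i) W →
      (sample L i)^[z] φ a ≤ ENNReal.ofReal
        (c₀ + (W.image (a.lab i)).card * (1 - 1 / ((n * (4 * k * e + 2) : ℕ) : ℝ)) ^ z) := by
  set T := n * (4 * k * e + 2) with hT
  have hTpos : 0 < T := by positivity
  set ρ : ℝ := 1 - 1 / (T : ℝ) with hρ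
  have hρ0 : 0 ≤ ρ := by
    rw [hρ, sub_nonneg]
    exact div_le_one_of_le₀ (by exact_mod_cast hTpos) (Nat.cast_nonneg _)
  induction z with
  | zero =>
    intro a W hv hs hW
    rw [Function.iterate_zero, id, pow_zero, mul_one]
    rcases W.eq_empty_or_nonempty with rfl | hne
    · exact (hφ a hv (hs.succ_of_charged hv hi he hW)).trans
        (ENNReal.ofReal_le_ofReal (by simp))
    · refine (hφ₁ a hv).trans (ENNReal.ofReal_le_ofReal ?_)
      have : 1 ≤ (W.image (a.lab i)).card := Finset.card_pos.2 (hne.image _)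
      have : (1 : ℝ) ≤ (W.image (a.lab i)).card := by exact_mod_cast this
      linarith
  | succ z ih =>
    intro a W hv hs hW
    have hK : a.rest G i ≤ G := fun u v h => h.1
    obtain ⟨W', hsub, hW', hact⟩ := hW.exists_active hK
    have hcard := card_image_le_of_active hact
    have hρz : 0 ≤ ρ ^ z := pow_nonneg hρ0 z
    rw [Function.iterate_succ_apply']
    have hpos : ∀ v ∈ W', (1 : ℝ) ≤ (W'.image (a.lab i)).card := fun v hv => by
      exact_mod_cast Finset.card_pos.2 ⟨_, Finset.mem_image_of_mem _ hv⟩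
    -- Merging two classes of `W'` lowers their number by at least one, hence the bound for the
    -- remaining `z` steps by at least `ρ ^ z`.
    refine (sample_le L (b := c₀ + (W'.image (a.lab i)).card * ρ ^ z) (c := ρ ^ z) (W := W')
      (l := a.lab i) hn hK (by positivity) hρz ?_ (ih a W' hv hs hW') ?_).trans
      (ENNReal.ofReal_le_ofReal ?_)
    · intro v hv w hw _
      nlinarith [hpos v hv]
    · intro v w
      have hW'' : Charged G ((a.step G i v w).rest G i) (4 * k * e + 1)
          ((a.step G i v w).lab i) W' := by
        rw [rest_step le_rfl]
        exact hW'.of_refines fun x y hxy => lab_step_eq_of_eq hxy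
      refine (ih _ W' (hv.step hi v w) (hs.step v w) hW'').trans (ENNReal.ofReal_le_ofReal ?_)
      split_ifs with hvw
      · have h1 : (W'.image ((a.step G i v w).lab i)).card + 1 ≤ (W'.image (a.lab i)).card := by
          rw [Levels.step, if_pos hvw.2.2]
          simpa using card_image_join hvw.1 hvw.2.1 hvw.2.2.2
        have h2 : ((W'.image ((a.step G i v w).lab i)).card : ℝ) + 1 ≤
            (W'.image (a.lab i)).card := by exact_mod_cast h1
        nlinarith
      · have h1 := card_image_le_of_refines (l := a.lab i) (l' := (a.step G i v w).lab i)
          (fun x y hxy => lab_step_eq_of_eq hxy) W'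
        have h2 : ((W'.image ((a.step G i v w).lab i)).card : ℝ) ≤
            (W'.image (a.lab i)).card := by exact_mod_cast h1
        nlinarith
    · have h1 : ((W'.image (a.lab i)).card : ℝ) ≤ (W.image (a.lab i)).card := by
        exact_mod_cast Finset.card_le_card (Finset.image_subset_image hsub)
      set Y := ∑ v ∈ W', ((a.rest G i).outDegree (a.lab i) W' v : ℝ) / G.degree v
      have hnR : (0 : ℝ) < n := by exact_mod_cast hn
      -- All classes of `W'` being active, the merging probability `Y / n` is at least their number
      -- over `T`.
      have h2 : ((W'.image (a.lab i)).card : ℝ) / T ≤ Y / n := by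
        have hTR : (T : ℝ) = n * (4 * k * e + 1 + 1) := by rw [hT]; push_cast; ring
        rw [hTR, div_le_div_iff₀ (by positivity) hnR]
        push_cast at hcard
        nlinarith
      have h3 : ρ ^ z / n * Y = ρ ^ z * (Y / n) := by ring
      have h4 : ((W'.image (a.lab i)).card : ℝ) * ρ ^ (z + 1) =
          (W'.image (a.lab i)).card * ρ ^ z -
            ρ ^ z * (((W'.image (a.lab i)).card : ℝ) / T) := by
        rw [pow_succ, hρ]
        ring
      have h5 := mul_le_mul_of_nonneg_left h2 hρz
      have h6 := mul_le_mul_of_nonneg_right h1 (pow_nonneg hρ0 (z + 1))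
      rw [h3]
      linarith

theorem one_sub_inv_pow_le {T s : ℕ} (hT : 0 < T) :
    (1 - 1 / (T : ℝ)) ^ (T * s) ≤ (1 / 2) ^ s := by
  have hTR : (1 : ℝ) ≤ T := by exact_mod_cast hT
  have h0 : 0 ≤ 1 - 1 / (T : ℝ) := sub_nonneg.2 (div_le_one_of_le₀ hTR (by positivity))
  rw [pow_mul]
  refine pow_le_pow_left₀ (pow_nonneg h0 _) ?_ s
  calc (1 - 1 / (T : ℝ)) ^ T ≤ Real.exp (-(1 / (T : ℝ))) ^ T :=
        pow_le_pow_left₀ h0 (Real.one_sub_le_exp_neg _) _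
    _ = Real.exp (-1) := by
        rw [← Real.exp_nat_mul]
        congr 1
        field_simp
    _ ≤ 1 / 2 := by
        rw [Real.exp_neg, one_div]
        exact inv_anti₀ (by norm_num) (by linarith [Real.exp_one_gt_d9])

/-- The probability that one of the levels from `i` on fails: a bound if all earlier levels are
sparse, and 1 otherwise. -/
noncomputable def failure (G : SimpleGraph (Fin n)) (e k : ℕ) (β : ℝ) (i : ℕ) (a : Levels n) :
    ℝ≥0∞ :=
  if Sparse G e i a then ENNReal.ofReal ((k - i : ℕ) * β) else 1

theorem sample_iterate_le_one (hi : i < k) (hn : 0 < n) (hφ : ∀ a, Valid G k a → φ a ≤ 1) (z : ℕ) :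
    ∀ a, Valid G k a → (sample L i)^[z] φ a ≤ 1 := by
  induction z with
  | zero => exact hφ
  | succ z ih =>
    intro a ha
    rw [Function.iterate_succ_apply']
    have := sample_le L (K := ⊥) (W := ∅) (l := id) (a := a) (i := i) (b := 1) (c := 0) hn bot_le
      zero_le_one le_rfl (by simp) (by simpa using ih a ha)
      (fun v w => by simpa using ih _ (ha.step hi v w))
    simpa using this

/-- With `s` the number of digits of `k * n ^ (c + 1)`, running `T * s` samples leaves an expected
number of classes of at most `n / 2 ^ s ≤ 1 / (k * n ^ c)`. This is the failure probability allotted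
to one level, so `failure` does not increase in expectation from level to level. -/
theorem sample_iterate_failure_le (hi : i < k) (he : 1 ≤ e) (hn : 0 < n) (c : ℕ)
    (ha : Valid G k a) :
    (sample L i)^[n * (4 * k * e + 2) * (k * n ^ (c + 1)).size]
        (failure G e k (1 / (k * n ^ c : ℕ)) (i + 1)) a ≤
      failure G e k (1 / (k * n ^ c : ℕ)) i a := by
  set β : ℝ := 1 / (k * n ^ c : ℕ) with hβ
  have hk : 0 < k := by omega
  have hkR : (0 : ℝ) < k := by exact_mod_cast hk
  have hnR : (0 : ℝ) < n := by exact_mod_cast hn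
  have hncR : (1 : ℝ) ≤ (n : ℝ) ^ c := one_le_pow₀ (by exact_mod_cast hn)
  have hβ0 : 0 ≤ β := by positivity
  have hle : ∀ j : ℕ, ((k - j : ℕ) : ℝ) * β ≤ 1 := fun j => by
    rw [hβ, mul_one_div]
    refine div_le_one_of_le₀ ?_ (Nat.cast_nonneg _)
    exact_mod_cast (Nat.sub_le k j).trans (Nat.le_mul_of_pos_right k (by positivity))
  have hle1 : ∀ j a, failure G e k β j a ≤ 1 := fun j a => by
    unfold failure
    split_ifs
    · exact ENNReal.ofReal_le_one.2 (hle j)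
    · exact le_rfl
  by_cases hs : Sparse G e i a
  · have h0 : 0 ≤ ((k - (i + 1) : ℕ) : ℝ) * β := by positivity
    refine (sample_iterate_le L hi he hn h0 (fun b _ => (hle1 _ b).trans ?_)
      (fun b _ hb => ?_) _ a Finset.univ ha hs charged_univ).trans ?_
    · rw [← ENNReal.ofReal_one]
      exact ENNReal.ofReal_le_ofReal (by linarith)
    · rw [failure, if_pos hb]
    · rw [failure, if_pos hs]
      refine ENNReal.ofReal_le_ofReal ?_
      have h1 : ((Finset.univ.image (a.lab i)).card : ℝ) ≤ n := by
        exact_mod_cast Finset.card_image_le.trans_eq (by simp)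
      have h2 := one_sub_inv_pow_le (T := n * (4 * k * e + 2)) (s := (k * n ^ (c + 1)).size)
        (by positivity)
      have h3 : ((1 : ℝ) / 2) ^ (k * n ^ (c + 1)).size ≤ 1 / (k * n ^ (c + 1)) := by
        rw [div_pow, one_pow]
        refine one_div_le_one_div_of_le (by positivity) ?_
        exact_mod_cast (Nat.lt_size_self (k * n ^ (c + 1))).le
      have h4 : (n : ℝ) * (1 / (k * n ^ (c + 1))) = β := by
        rw [hβ]
        push_cast
        field_simp
        ring
      have h5 : ((k - i : ℕ) : ℝ) = ((k - (i + 1) : ℕ) : ℝ) + 1 := by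
        exact_mod_cast (by omega : k - i = k - (i + 1) + 1)
      have h6 : ((Finset.univ.image (a.lab i)).card : ℝ) *
          (1 - 1 / ((n * (4 * k * e + 2) : ℕ) : ℝ)) ^
            (n * (4 * k * e + 2) * (k * n ^ (c + 1)).size) ≤ β := by
        rw [← h4]
        exact mul_le_mul h1 (h2.trans h3) (pow_nonneg (sub_nonneg.2 (div_le_one_of_le₀ (by
          exact_mod_cast (by positivity : 0 < n * (4 * k * e + 2))) (Nat.cast_nonneg _))) _) hnR.le
      rw [h5]
      linarith
  · rw [failure, if_neg hs]
    exact sample_iterate_le_one L hi hn (fun b _ => hle1 _ b) _ a ha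

end Levels

/-! ### Union by size. -/

namespace Levels

open scoped Classical
open SimpleGraph

variable {n : ℕ}

/-- Pointers `p` to parents (shifted by one, 0 for a root) of depth logarithmic in `n`, whose roots
are the labels `l`; at the roots, `z` holds one less than the size of the class. -/
def UnionFind (l : Fin n → Fin n) (p z : Fin n → ℕ) : Prop :=
  (∀ v, z (l v) + 1 = classSize l (l v)) ∧
  ∃ d : Fin n → ℕ, ∀ v, 2 ^ d v ≤ classSize l (l v) ∧
    ((p v = 0 ∧ l v = v ∧ d v = 0) ∨ ∃ w : Fin n, p v = w + 1 ∧ l w = l v ∧ d w < d v)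

variable {l : Fin n → Fin n} {p z : Fin n → ℕ}

theorem classSize_le (l : Fin n → Fin n) (c : Fin n) : classSize l c ≤ n :=
  (Finset.card_le_univ _).trans_eq (Fintype.card_fin n)

/-- Shifting pointers by one and storing sizes minus one makes the all-zero memory encode
singletons, so the levels need no initialization. -/
theorem unionFind_id : UnionFind (fun v : Fin n => v) (fun _ => 0) (fun _ => 0) :=
  have h1 : ∀ v : Fin n, classSize (fun v : Fin n => v) v = 1 := fun v =>
    Finset.card_eq_one.2 ⟨v, by ext x; rw [Finset.mem_filter, Finset.mem_singleton]; simp⟩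
  ⟨fun v => (h1 v).symm, fun _ => 0, fun v => ⟨(h1 v).ge, Or.inl ⟨rfl, rfl, rfl⟩⟩⟩

theorem root_of_unionFind {d : Fin n → ℕ}
    (hd : ∀ v, 2 ^ d v ≤ classSize l (l v) ∧
      ((p v = 0 ∧ l v = v ∧ d v = 0) ∨ ∃ w : Fin n, p v = w + 1 ∧ l w = l v ∧ d w < d v))
    (v : Fin n) : l (l v) = l v ∧ p (l v) = 0 ∧ d (l v) = 0 := by
  induction hm : d v using Nat.strong_induction_on generalizing v with
  | _ m ih =>
    rcases (hd v).2 with ⟨h1, h2, h3⟩ | ⟨w, -, h2, h3⟩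
    · rw [h2]
      exact ⟨h2, h1, h3⟩
    · rw [← h2]
      exact ih _ (hm ▸ h3) w rfl

theorem classSize_relabel (l : Fin n → Fin n) {p q : Fin n} (h : p ≠ q) :
    classSize (relabel l p q) q = classSize l p + classSize l q := by
  unfold classSize
  rw [← Finset.card_union_of_disjoint]
  · congr 1
    ext x
    rw [Finset.mem_union, Finset.mem_filter, Finset.mem_filter, Finset.mem_filter]
    simp only [relabel, Finset.mem_univ, true_and]
    split_ifs with hx <;> simp [hx, h]
  · rw [Finset.disjoint_left]
    intro x hx hx'
    exact h ((Finset.mem_filter.1 hx).2.symm.trans (Finset.mem_filter.1 hx').2)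

theorem classSize_relabel_of_ne (l : Fin n → Fin n) {p q c : Fin n} (h : c ≠ p) (h' : c ≠ q) :
    classSize (relabel l p q) c = classSize l c := by
  unfold classSize
  congr 1
  ext x
  rw [Finset.mem_filter, Finset.mem_filter]
  simp only [relabel, Finset.mem_univ, true_and]
  split_ifs with hx
  · simp [hx, h.symm, h'.symm]
  · rfl

/-- The depth bounds `d` grow by one exactly in the smaller class, whose nodes then lie in a class
at least twice as large; this preserves `2 ^ d v ≤ classSize`. -/
theorem UnionFind.link (h : UnionFind l p z) {v w : Fin n} (hne : l v ≠ l w)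
    (hle : classSize l (l v) ≤ classSize l (l w)) :
    UnionFind (relabel l (l v) (l w)) (Function.update p (l v) (l w + 1))
      (Function.update z (l w) (z (l w) + z (l v) + 1)) := by
  obtain ⟨hz, d, hd⟩ := h
  have hroot := fun x => root_of_unionFind hd x
  have hrel : ∀ x, (l x = l v ∧ relabel l (l v) (l w) x = l w) ∨
      (l x ≠ l v ∧ relabel l (l v) (l w) x = l x) := fun x => by
    unfold relabel
    split_ifs with hx
    · exact Or.inl ⟨hx, rfl⟩
    · exact Or.inr ⟨hx, rfl⟩
  have hlw : relabel l (l v) (l w) (l w) = l w := by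
    unfold relabel
    rw [(hroot w).1, if_neg hne.symm]
  have hsum := classSize_relabel l hne
  constructor
  · intro x
    rcases hrel x with ⟨-, h2⟩ | ⟨h1, h2⟩
    · rw [h2, hsum, Function.update_self, ← hz v, ← hz w]
      omega
    · rw [h2]
      by_cases hx : l x = l w
      · rw [hx, hsum, Function.update_self, ← hz v, ← hz w]
        omega
      · rw [classSize_relabel_of_ne l h1 hx, Function.update_of_ne hx, hz x]
  · refine ⟨fun x => if l x = l v then d x + 1 else d x, fun x => ⟨?_, ?_⟩⟩
    · have hdx := (hd x).1
      dsimp only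
      rcases hrel x with ⟨h1, h2⟩ | ⟨h1, h2⟩
      · rw [h2, hsum, if_pos h1, pow_succ]
        rw [h1] at hdx
        omega
      · rw [h2, if_neg h1]
        by_cases hx : l x = l w
        · rw [hx] at hdx ⊢
          omega
        · rwa [classSize_relabel_of_ne l h1 hx]
    · by_cases hxv : x = l v
      · right
        subst hxv
        refine ⟨l w, Function.update_self _ _ _, ?_, ?_⟩
        · rw [hlw]
          unfold relabel
          rw [(hroot v).1, if_pos rfl]
        · dsimp only
          rw [(hroot v).1, (hroot w).1, if_pos rfl, if_neg hne.symm, (hroot w).2.2]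
          omega
      · rw [Function.update_of_ne hxv]
        rcases (hd x).2 with ⟨h1, h2, h3⟩ | ⟨y, h1, h2, h3⟩
        · left
          have hne' : l x ≠ l v := by rwa [h2]
          refine ⟨h1, ?_, ?_⟩
          · unfold relabel
            rw [if_neg hne', h2]
          · dsimp only
            rw [if_neg hne', h3]
        · right
          refine ⟨y, h1, relabel_eq_of_eq _ _ h2, ?_⟩
          dsimp only
          rw [h2]
          split_ifs <;> omega

end Levels

namespace RAM

open scoped Classical
open SimpleGraph Levels

/-! ### The programs -/

/-- The address of cell `b` of row `a`, where register 0 holds the length of a row. -/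
def addr (t : ℕ) (a b : Exp) : Exp :=
  .op .add (.op .mul (.lit 4) (.op .add (.op .mul a (.reg 0)) b)) (.lit t)

/-- Replace the node in register `x` by its root at the level in register 8. -/
def findRoot (x : ℕ) : Prog :=
  .loop (.load (addr 1 (.reg 8) (.reg x)))
    (.assign x (.op .sub (.load (addr 1 (.reg 8) (.reg x))) (.lit 1)))

/-- Put the roots of the nodes in registers 6 and 7 into registers 9 and 10. -/
def findRoots : Prog :=
  .seq (.assign 9 (.reg 6)) (.seq (.assign 10 (.reg 7)) (.seq (findRoot 9) (findRoot 10)))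

/-- Set register 11 to 1 if, at a level less than register 5, the nodes in registers 6 and 7 have
different roots. -/
def compareLevels : Prog :=
  .seq (.assign 8 (.lit 0))
    (.loop (.op .lt (.reg 8) (.reg 5))
      (.seq findRoots
        (.seq (.ite (.op .eq (.reg 9) (.reg 10)) .skip (.assign 11 (.lit 1)))
          (.assign 8 (.op .add (.reg 8) (.lit 1))))))

/-- Make the root in register `y` the parent of the root in register `x`. -/
def attach (x y : ℕ) : Prog :=
  .seq (.store (addr 1 (.reg 8) (.reg x)) (.op .add (.reg y) (.lit 1)))
    (.store (addr 2 (.reg 8) (.reg y))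
      (.op .add (.op .add (.load (addr 2 (.reg 8) (.reg y))) (.load (addr 2 (.reg 8) (.reg x))))
        (.lit 1)))

/-- Add the edge between the nodes in registers 6 and 7 to the forest. -/
def addEdge : Prog :=
  .seq (.store (addr 3 (.reg 6) (.reg 7)) (.lit 1))
    (.seq (.store (addr 3 (.reg 7) (.reg 6)) (.lit 1))
      (.ite (.op .lt (.load (addr 2 (.reg 8) (.reg 9))) (.load (addr 2 (.reg 8) (.reg 10))))
        (attach 9 10) (attach 10 9)))

/-- Process the pair of nodes in registers 6 and 7 at the level in register 5. -/
def tryEdge : Prog :=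
  .seq (.assign 11 (.op .add (.op .eq (.adj (.reg 6) (.reg 7)) (.lit 0))
      (.load (addr 3 (.reg 6) (.reg 7)))))
    (.seq compareLevels (.seq findRoots
      (.ite (.op .add (.reg 11) (.op .eq (.reg 9) (.reg 10))) .skip addEdge)))

/-- Process a random edge at a random node, and count register 4 down. -/
def sampleEdge : Prog :=
  .seq (.rand 6 (.reg 0)) (.seq (.rand 7 (.deg (.reg 6)))
    (.seq (.assign 7 (.nbr (.reg 6) (.reg 7)))
      (.seq tryEdge (.assign 4 (.op .sub (.reg 4) (.lit 1))))))

/-- The program that answers queries. -/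
def query : Prog :=
  .seq (.assign 6 (.reg 0)) (.seq (.assign 7 (.reg 1)) (.seq (.assign 0 (.load (.lit 0)))
    (.seq (.assign 5 (.load (.lit 4)))
      (.ite (.adj (.reg 6) (.reg 7))
        (.ite (.load (addr 3 (.reg 6) (.reg 7))) (.assign 0 (.lit 1))
          (.seq compareLevels (.assign 0 (.reg 11))))
        (.assign 0 (.lit 0))))))

theorem isQuery_query : query.IsQuery := by
  simp [query, compareLevels, findRoots, findRoot, addr, Prog.IsQuery, Exp.OnlyMatrix]

/-! ### The memory -/

/-- Residues modulo 4 separate the tables of parents, sizes and edge marks from each other and from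
cells 0 and 4; within a table the row-major index is injective because nodes are less than `n`. -/
theorem addr_eq_iff {n : ℕ} {t t' i j : ℕ} {v w : Fin n} (ht : t < 4) (ht' : t' < 4) :
    4 * (i * n + v) + t = 4 * (j * n + w) + t' ↔ t = t' ∧ i = j ∧ v = w := by
  constructor
  · intro h
    have h1 : t = t' := by omega
    have h2 : i * n + v = j * n + w := by omega
    have hn : 0 < n := v.pos
    have h3 : (i * n + v) / n = (j * n + w) / n := by rw [h2]
    have h4 : (i * n + v) % n = (j * n + w) % n := by rw [h2]
    rw [Nat.mul_add_mod_self_right, Nat.mul_add_mod_self_right, Nat.mod_eq_of_lt v.2,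
      Nat.mod_eq_of_lt w.2] at h4
    rw [Nat.mul_comm i, Nat.mul_comm j, Nat.mul_add_div hn, Nat.mul_add_div hn,
      Nat.div_eq_of_lt v.2, Nat.div_eq_of_lt w.2] at h3
    exact ⟨h1, by omega, Fin.ext h4⟩
  · rintro ⟨rfl, rfl, rfl⟩
    rfl

/-- The memory `m` holds `n`, `k` and the levels `a`. -/
structure Represents {n : ℕ} (k : ℕ) (a : Levels n) (m : ℕ → ℕ) : Prop where
  nodes : m 0 = n
  levels : m 4 = k
  edge : ∀ u v : Fin n,
    m (4 * (u * n + v) + 3) = if ∃ j, s(u, v) ∈ a.forest j then 1 else 0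
  unionFind : ∀ j, UnionFind (a.lab j) (fun v => m (4 * (j * n + v) + 1))
    (fun v => m (4 * (j * n + v) + 2))

/-- The memory after `attach`. -/
def attached (n i : ℕ) (p q : Fin n) (m : ℕ → ℕ) : ℕ → ℕ :=
  Function.update (Function.update m (4 * (i * n + p) + 1) (q + 1)) (4 * (i * n + q) + 2)
    (m (4 * (i * n + q) + 2) + m (4 * (i * n + p) + 2) + 1)

/-- The memory after the edge `vw` has been marked. -/
def marked (n : ℕ) (v w : Fin n) (m : ℕ → ℕ) : ℕ → ℕ :=
  Function.update (Function.update m (4 * (v * n + w) + 3) 1) (4 * (w * n + v) + 3) 1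

variable {n : ℕ} {G : SimpleGraph (Fin n)} {k : ℕ} {a : Levels n} {m : ℕ → ℕ} {i : ℕ}

theorem attached_marked_edge (p q v w x y : Fin n) :
    attached n i p q (marked n v w m) (4 * (x * n + y) + 3) =
      if s(x, y) = s(v, w) then 1 else m (4 * (x * n + y) + 3) := by
  unfold attached marked
  rw [Function.update_of_ne (by omega), Function.update_of_ne (by omega), Function.update_apply,
    Function.update_apply]
  simp only [addr_eq_iff (show 3 < 4 by omega) (show 3 < 4 by omega), Fin.val_inj, Sym2.eq_iff,
    true_and]
  split_ifs <;> first | rfl | (exfalso; tauto)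

theorem attached_marked_parent (p q v w : Fin n) (j : ℕ) (x : Fin n) :
    attached n i p q (marked n v w m) (4 * (j * n + x) + 1) =
      if j = i ∧ x = p then (q : ℕ) + 1 else m (4 * (j * n + x) + 1) := by
  unfold attached marked
  rw [Function.update_of_ne (by omega), Function.update_apply, Function.update_of_ne (by omega),
    Function.update_of_ne (by omega)]
  simp only [addr_eq_iff (show 1 < 4 by omega) (show 1 < 4 by omega), true_and]

theorem attached_marked_size (p q v w : Fin n) (j : ℕ) (x : Fin n) :
    attached n i p q (marked n v w m) (4 * (j * n + x) + 2) =
      if j = i ∧ x = q then m (4 * (i * n + q) + 2) + m (4 * (i * n + p) + 2) + 1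
      else m (4 * (j * n + x) + 2) := by
  have h : ∀ x : ℕ, marked n v w m (4 * x + 2) = m (4 * x + 2) := fun x => by
    unfold marked
    rw [Function.update_of_ne (by omega), Function.update_of_ne (by omega)]
  unfold attached
  rw [Function.update_apply, Function.update_of_ne (by omega), h, h, h]
  simp only [addr_eq_iff (show 2 < 4 by omega) (show 2 < 4 by omega), true_and]

theorem Represents.attached_marked (h : Represents k a m) {v w : Fin n} {p q : Fin n}
    {b : Levels n} (hb : b.lab = Function.update a.lab i (relabel (a.lab i) p q))
    (hf : b.forest = Function.update a.forest i (insert s(v, w) (a.forest i)))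
    (hp : ∃ x y, a.lab i x = p ∧ a.lab i y = q) (hne : p ≠ q)
    (hle : classSize (a.lab i) p ≤ classSize (a.lab i) q) :
    Represents k b (attached n i p q (marked n v w m)) := by
  obtain ⟨x, y, rfl, rfl⟩ := hp
  constructor
  · refine Eq.trans ?_ h.nodes
    simp [attached, marked, Function.update_apply]
  · refine Eq.trans ?_ h.levels
    have h1 : ∀ x, (4 : ℕ) ≠ 4 * x + 1 := by omega
    have h2 : ∀ x, (4 : ℕ) ≠ 4 * x + 2 := by omega
    have h3 : ∀ x, (4 : ℕ) ≠ 4 * x + 3 := by omega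
    simp [attached, marked, Function.update_apply, h1, h2, h3]
  · intro u' v'
    have hex : (∃ j, s(u', v') ∈ b.forest j) ↔
        (∃ j, s(u', v') ∈ a.forest j) ∨ s(u', v') = s(v, w) := by
      rw [hf]
      constructor
      · rintro ⟨j, hj⟩
        by_cases hji : j = i
        · subst hji
          simp only [Function.update_self, Finset.mem_insert] at hj
          rcases hj with hj | hj
          · exact Or.inr hj
          · exact Or.inl ⟨j, hj⟩
        · rw [Function.update_of_ne hji] at hj
          exact Or.inl ⟨j, hj⟩
      · rintro (⟨j, hj⟩ | hj)
        · refine ⟨j, ?_⟩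
          by_cases hji : j = i
          · subst hji
            simp [hj]
          · rwa [Function.update_of_ne hji]
        · exact ⟨i, by simp [hj]⟩
    have he := h.edge u' v'
    rw [attached_marked_edge, he]
    simp only [hex]
    split_ifs <;> first | rfl | (exfalso; tauto)
  · intro j
    simp only [attached_marked_parent, attached_marked_size]
    rw [hb]
    by_cases hj : j = i
    · subst hj
      convert (h.unionFind j).link hne hle using 1
      · simp
      · funext u
        simp [Function.update_apply]
      · funext u
        simp [Function.update_apply]
    · simp only [hj, false_and, if_false]
      rw [Function.update_of_ne hj]
      exact h.unionFind j

theorem represents_start : Represents k (start n) (Function.update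
    (Function.update (fun _ => 0) 0 n) 4 k) := by
  have h1 : ∀ x, (4 * x + 1 : ℕ) ≠ 4 := by omega
  have h2 : ∀ x, (4 * x + 2 : ℕ) ≠ 4 := by omega
  have h3 : ∀ x, (4 * x + 3 : ℕ) ≠ 4 := by omega
  constructor
  · simp
  · simp
  · simp [start, h3]
  · intro j
    simp [start, h1, h2, unionFind_id]

end RAM

/-! ### Correctness and time of processing one edge. -/

namespace RAM

open scoped Classical
open SimpleGraph Levels

variable {n : ℕ} {G : SimpleGraph (Fin n)} {L : AdjList G} {k : ℕ} {a : Levels n} {r m : ℕ → ℕ}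
  {fuel K M : ℕ}

/-- The depth bound is less than `n.size`, because 2 to its power is at most the size of a class. -/
theorem findRoot_halts (hK : 1000 ≤ K) (hM : M < fuel) (hB : Bdd n M r m) {x j : ℕ} (hx : x ≠ 0)
    (hx8 : x ≠ 8) {v : Fin n} (hr0 : r 0 = n) (hr8 : r 8 = j) (hrx : r x = v)
    {l : Fin n → Fin n} {z : Fin n → ℕ}
    (hl : UnionFind l (fun v => m (4 * (j * n + v) + 1)) z) :
    Halts L fuel (findRoot x) (2 * n.size * unit K M) r m fun r' m' =>
      r' = Function.update r x (l v) ∧ m' = m := by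
  obtain ⟨-, d, hd⟩ := hl
  beta_reduce at hd
  have hdv : d v < n.size := Nat.lt_size.2 ((hd v).1.trans (classSize_le l _))
  have hsz : n.size ≤ n := Nat.size_le.2 Nat.lt_two_pow_self
  have heval : ∀ w : Fin n, (Exp.load (addr 1 (.reg 8) (.reg x))).eval L
      ⟨Function.update r x w, m, 0⟩ = m (4 * (j * n + w) + 1) := fun w => by
    simp [Exp.eval, addr, Op.eval, Function.update_of_ne hx.symm, Function.update_of_ne hx8.symm,
      hr0, hr8]
  refine Halts.loop (K := K) (M := M) (T := unit K M) (j := d v)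
    (I := fun j' r' m' => m' = m ∧ ∃ w : Fin n, r' = Function.update r x w ∧ d w ≤ j' ∧ l w = l v)
    ?_ ?_ ?_ ?_ ?_ ?_ ?_
  · exact lt_of_lt_of_le (by simp [Exp.wt, Exp.wid, addr]) hK
  · have := hB.nodes
    omega
  · nlinarith [Nat.mul_le_mul_right (unit K M) (Nat.succ_le_iff.2 hdv)]
  · exact ⟨rfl, v, by rw [← hrx, Function.update_eq_self], le_rfl, rfl⟩
  · rintro j' r' m' ⟨rfl, w, rfl, -, -⟩
    exact hB.setReg x (w.2.le.trans hB.nodes)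
  · rintro j' r' m' ⟨rfl, w, rfl, -, hw⟩ h0
    rw [heval] at h0
    refine ⟨?_, rfl⟩
    rcases (hd w).2 with ⟨-, h2, -⟩ | ⟨w', h1, -, -⟩
    · rw [← hw, h2]
    · omega
  · rintro j' r' m' ⟨rfl, w, rfl, hwj, hw⟩ h0
    rw [heval] at h0
    rcases (hd w).2 with ⟨h1, -, -⟩ | ⟨w', h1, h2, h3⟩
    · exact absurd h1 h0
    · refine ⟨j' - 1, by omega, Halts.assign (M := M) (hB.setReg x (w.2.le.trans hB.nodes))
        (lt_of_lt_of_le (by simp [Exp.wt, Exp.wid, addr]) hK) ⟨rfl, w', ?_, by omega, h2.trans hw⟩⟩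
      have : (Exp.op .sub (.load (addr 1 (.reg 8) (.reg x))) (.lit 1)).eval L
          ⟨Function.update r x w, m', 0⟩ = w' := by
        change (Exp.load (addr 1 (.reg 8) (.reg x))).eval L ⟨Function.update r x w, m', 0⟩ - 1 = _
        rw [heval, h1]
        rfl
      rw [this, Function.update_idem]

theorem findRoots_halts (hK : 1000 ≤ K) (hM : M < fuel) (hB : Bdd n M r m) {j : ℕ} {v w : Fin n}
    (hr0 : r 0 = n) (hr8 : r 8 = j) (hr6 : r 6 = v) (hr7 : r 7 = w) (ha : Represents k a m) :
    Halts L fuel findRoots ((4 * n.size + 2) * unit K M) r m fun r' m' =>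
      m' = m ∧ Bdd n M r' m ∧ r' 9 = a.lab j v ∧ r' 10 = a.lab j w ∧
        ∀ x, x ≠ 9 → x ≠ 10 → r' x = r x := by
  have hv : (v : ℕ) ≤ M := v.2.le.trans hB.nodes
  have hw : (w : ℕ) ≤ M := w.2.le.trans hB.nodes
  have hB1 := hB.setReg 9 hv
  have hB2 := hB1.setReg 10 hw
  refine Halts.seq (T₁ := unit K M) (T₂ := (4 * n.size + 1) * unit K M) (Halts.assign hB
    (lt_of_lt_of_le (by simp [Exp.wt]) hK) ?_) (by nlinarith)
  simp only [Exp.eval, hr6]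
  refine Halts.seq (T₁ := unit K M) (T₂ := (4 * n.size) * unit K M) (Halts.assign hB1
    (lt_of_lt_of_le (by simp [Exp.wt]) hK) ?_) (by nlinarith)
  simp only [Exp.eval, Function.update_of_ne (show 7 ≠ 9 by decide), hr7]
  refine Halts.seq (T₁ := 2 * n.size * unit K M) (T₂ := 2 * n.size * unit K M)
    ((findRoot_halts hK hM hB2 (j := j) (v := v) (by decide) (by decide) (by simpa using hr0)
      (by simpa using hr8) (by simp) (ha.unionFind j)).mono le_rfl ?_) (by nlinarith)
  rintro r' m' ⟨rfl, rfl⟩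
  have hB3 := hB2.setReg 9 ((a.lab j v).2.le.trans hB.nodes)
  refine (findRoot_halts hK hM hB3 (j := j) (v := w) (by decide) (by decide) (by simpa using hr0)
      (by simpa using hr8) (by simp) (ha.unionFind j)).mono le_rfl ?_
  rintro r' m'' ⟨rfl, rfl⟩
  exact ⟨rfl, hB3.setReg 10 ((a.lab j w).2.le.trans hB.nodes), by simp, by simp,
    fun x h9 h10 => by simp [h9, h10]⟩

theorem compareLevels_halts (hK : 1000 ≤ K) (hM : M < fuel) (hM1 : 1 ≤ M) (hB : Bdd n M r m)
    {v w : Fin n} (hr0 : r 0 = n) (hr6 : r 6 = v) (hr7 : r 7 = w) (ha : Represents k a m) :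
    Halts L fuel compareLevels ((r 5 + 1) * (4 * n.size + 7) * unit K M) r m fun r' m' =>
      m' = m ∧ Bdd n M r' m ∧ r' 8 = r 5 ∧
        r' 11 = (if ∀ j < r 5, a.lab j v = a.lab j w then r 11 else 1) ∧
        ∀ x, x ≠ 8 → x ≠ 9 → x ≠ 10 → x ≠ 11 → r' x = r x := by
  have hB1 := hB.setReg 8 (Nat.zero_le M)
  refine Halts.seq (T₁ := unit K M)
    (T₂ := (r 5 + 1) * unit K M + r 5 * ((4 * n.size + 5) * unit K M))
    (Halts.assign hB (lt_of_lt_of_le (by simp [Exp.wt]) hK) ?_)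
    (by nlinarith [Nat.zero_le (n.size * unit K M), Nat.zero_le (r 5 * unit K M)])
  simp only [Exp.eval]
  -- The budget `j'` is the number of levels still to be compared, and register 11 records the
  -- comparison of those below register 8.
  refine Halts.loop (K := K) (M := M) (T := (4 * n.size + 5) * unit K M) (j := r 5)
    (I := fun j' r' m' => m' = m ∧ Bdd n M r' m ∧ r' 8 + j' = r 5 ∧
      (r' 11 = if ∀ j < r' 8, a.lab j v = a.lab j w then r 11 else 1) ∧
      ∀ x, x ≠ 8 → x ≠ 9 → x ≠ 10 → x ≠ 11 → r' x = r x) ?_ ?_ le_rfl ?_ ?_ ?_ ?_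
  · exact lt_of_lt_of_le (by simp [Exp.wt, Exp.wid]) hK
  · exact (hB.reg 5).trans_lt hM
  · exact ⟨rfl, hB1, by simp, by simp, fun x h8 _ _ _ => by simp [h8]⟩
  · rintro j' r' m' ⟨rfl, h, -⟩
    exact h
  · rintro j' r' m' ⟨rfl, h1, h2, h3, h4⟩ h0
    have h5 := h4 5 (by decide) (by decide) (by decide) (by decide)
    have h8 : r' 8 = r 5 := by
      simp only [Exp.eval, Op.eval, h5] at h0
      split_ifs at h0
      omega
    exact ⟨rfl, h1, h8, by rw [h3, h8], h4⟩
  · rintro j' r' m' ⟨rfl, h1, h2, h3, h4⟩ h0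
    have h5 := h4 5 (by decide) (by decide) (by decide) (by decide)
    have h8 : r' 8 < r 5 := by
      simp only [Exp.eval, Op.eval, h5] at h0
      split_ifs at h0 with h
      · exact h
      · exact absurd rfl h0
    refine ⟨j' - 1, by omega, ?_⟩
    refine Halts.seq (T₁ := (4 * n.size + 2) * unit K M) (T₂ := 3 * unit K M)
      ((findRoots_halts hK hM h1 (j := r' 8) (v := v) (w := w)
        ((h4 0 (by decide) (by decide) (by decide) (by decide)).trans hr0) rfl
        ((h4 6 (by decide) (by decide) (by decide) (by decide)).trans hr6)
        ((h4 7 (by decide) (by decide) (by decide) (by decide)).trans hr7) ha).mono le_rfl ?_)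
      (by nlinarith)
    rintro r₁ m₁ ⟨rfl, g1, g2, g3, g4⟩
    have g8 := g4 8 (by decide) (by decide)
    have g11 := g4 11 (by decide) (by decide)
    refine Halts.seq (T₁ := 2 * unit K M) (T₂ := unit K M) (Q := _) ?_ (by nlinarith)
    have hpos : 1 ≤ unit K M := by
      unfold unit
      exact Nat.mul_pos (by omega) (by positivity)
    have hB8 : r' 8 + 1 ≤ M := h8.trans_le (hB.reg 5)
    refine Halts.ite (T := unit K M) g1 (lt_of_lt_of_le (by simp [Exp.wt, Exp.wid]) hK)
      (by nlinarith) ?_ ?_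
    · intro heq
      have heq' : a.lab (r' 8) v = a.lab (r' 8) w := by
        simp only [Exp.eval, Op.eval, g2, g3] at heq
        split_ifs at heq with h
        · exact Fin.ext h
        · exact absurd rfl heq
      refine Halts.skip hpos (Halts.assign g1 (lt_of_lt_of_le (by simp [Exp.wt, Exp.wid]) hK) ?_)
      simp only [Exp.eval, Op.eval, g8]
      refine ⟨trivial, g1.setReg 8 hB8, by simp; omega, ?_, fun x x8 x9 x10 x11 => ?_⟩
      · have hiff : (∀ j ≤ r' 8, a.lab j v = a.lab j w) ↔ ∀ j < r' 8, a.lab j v = a.lab j w :=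
          ⟨fun h j hj => h j hj.le, fun h j hj => hj.lt_or_eq.elim (h j) fun e => e ▸ heq'⟩
        simp [g11, h3, hiff]
      · rw [Function.update_of_ne x8, g4 x x9 x10, h4 x x8 x9 x10 x11]
    · intro heq
      have heq' : a.lab (r' 8) v ≠ a.lab (r' 8) w := by
        simp only [Exp.eval, Op.eval, g2, g3] at heq
        split_ifs at heq with h
        exact fun h' => h (congrArg Fin.val h')
      refine Halts.assign g1 (lt_of_lt_of_le (by simp [Exp.wt]) hK) ?_
      simp only [Exp.eval]
      have g1' := g1.setReg 11 hM1
      refine Halts.assign g1' (lt_of_lt_of_le (by simp [Exp.wt, Exp.wid]) hK) ?_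
      simp only [Exp.eval, Op.eval, Function.update_of_ne (show 8 ≠ 11 by decide), g8]
      refine ⟨trivial, g1'.setReg 8 hB8, by simp; omega, ?_, fun x x8 x9 x10 x11 => ?_⟩
      · rw [if_neg fun hh => heq' (hh (r' 8) (by simp))]
        simp
      · rw [Function.update_of_ne x8, Function.update_of_ne x11, g4 x x9 x10,
          h4 x x8 x9 x10 x11]

theorem attach_halts (hK : 1000 ≤ K) (hB : Bdd n M r m) {x y i : ℕ} {p q : Fin n}
    (hr0 : r 0 = n) (hr8 : r 8 = i) (hrx : r x = p) (hry : r y = q)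
    (hz : m (4 * (i * n + q) + 2) + m (4 * (i * n + p) + 2) + 1 ≤ M) :
    Halts L fuel (attach x y) (2 * unit K M) r m fun r' m' =>
      r' = r ∧ m' = attached n i p q m ∧ Bdd n M r' m' := by
  have hq : (q : ℕ) + 1 ≤ M := q.2.trans_le hB.nodes
  have hB1 := hB.setMem (4 * (i * n + p) + 1) hq
  refine Halts.seq (T₁ := unit K M) (T₂ := unit K M) (Halts.store hB
    (lt_of_lt_of_le (by simp [Exp.wt, Exp.wid, addr]) hK) ?_) (by nlinarith)
  simp only [Exp.eval, addr, Op.eval, hr0, hr8, hrx, hry]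
  refine Halts.store hB1 (lt_of_lt_of_le (by simp [Exp.wt, Exp.wid]) hK) ?_
  have h2 : ∀ u, Function.update m (4 * (i * n + p) + 1) (q + 1) (4 * u + 2) = m (4 * u + 2) :=
    fun u => Function.update_of_ne (by omega) _ _
  simp only [Exp.eval, Op.eval, hr0, hr8, hrx, hry, h2]
  exact ⟨trivial, rfl, hB1.setMem _ hz⟩

/-- The registers and the memory between two steps of the preprocessing at level `i`. -/
structure Good (G : SimpleGraph (Fin n)) (k Z M i : ℕ) (a : Levels n) (r m : ℕ → ℕ) : Prop where
  reg0 : r 0 = n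
  reg1 : r 1 = k
  reg3 : r 3 = Z
  reg5 : r 5 = i
  bdd : Bdd n M r m
  represents : Represents k a m
  valid : Valid G k a

variable {Z i : ℕ}

theorem addEdge_halts (hK : 1000 ≤ K) (hM1 : 1 ≤ M) (h : Good G k Z M i a r m) (hi : i < k)
    {v w : Fin n} (hr6 : r 6 = v) (hr7 : r 7 = w) (hr8 : r 8 = i) (hr9 : r 9 = a.lab i v)
    (hr10 : r 10 = a.lab i w) (hc : ((a.rest G i).cross (a.lab i)).Adj v w) :
    Halts L fuel addEdge (5 * unit K M) r m fun r' m' =>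
      r' = r ∧ Good G k Z M i (a.step G i v w) r' m' := by
  have hB := h.bdd
  have hB1 := hB.setMem (4 * (v * n + w) + 3) hM1
  have hB2 := hB1.setMem (4 * (w * n + v) + 3) hM1
  refine Halts.seq (T₁ := unit K M) (T₂ := 4 * unit K M) (Halts.store hB
    (lt_of_lt_of_le (by simp [Exp.wt, Exp.wid, addr]) hK) ?_) (by nlinarith)
  simp only [Exp.eval, addr, Op.eval, h.reg0, hr6, hr7]
  refine Halts.seq (T₁ := unit K M) (T₂ := 3 * unit K M) (Halts.store hB1
    (lt_of_lt_of_le (by simp [Exp.wt, Exp.wid]) hK) ?_) (by nlinarith)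
  simp only [Exp.eval, Op.eval, h.reg0, hr6, hr7]
  change Halts L fuel _ _ r (marked n v w m) _
  have hmark : ∀ u : Fin n, marked n v w m (4 * (i * n + u) + 2) = m (4 * (i * n + u) + 2) :=
    fun u => by
      unfold marked
      rw [Function.update_of_ne (by omega), Function.update_of_ne (by omega)]
  have hz := (h.represents.unionFind i).1
  have hzv : m (4 * (i * n + a.lab i v) + 2) + 1 = _ := hz v
  have hzw : m (4 * (i * n + a.lab i w) + 2) + 1 = _ := hz w
  have hsum : classSize (a.lab i) (a.lab i v) + classSize (a.lab i) (a.lab i w) ≤ n := by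
    rw [← classSize_relabel _ hc.2]
    exact classSize_le _ _
  have hvalid := h.valid.step hi v w
  have hn := hB.nodes
  refine Halts.ite (T := 2 * unit K M) hB2 (lt_of_lt_of_le (by simp [Exp.wt, Exp.wid]) hK)
    (by nlinarith) ?_ ?_
  · intro hlt
    simp only [Exp.eval, Op.eval, h.reg0, hr8, hr9, hr10, hmark] at hlt
    split_ifs at hlt with hlt'
    swap
    · exact absurd rfl hlt
    refine (attach_halts hK hB2 h.reg0 hr8 hr9 hr10 (by
      change marked n v w m _ + marked n v w m _ + 1 ≤ M
      rw [hmark, hmark]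
      omega)).mono le_rfl ?_
    rintro r' m' ⟨rfl, rfl, hB'⟩
    refine ⟨rfl, h.reg0, h.reg1, h.reg3, h.reg5, hB', ?_, hvalid⟩
    refine h.represents.attached_marked ?_ ?_ ⟨v, w, rfl, rfl⟩ hc.2 (by omega)
    · rw [Levels.step, if_pos hc]
      simp only [join]
      rw [if_pos (by omega)]
    · rw [Levels.step, if_pos hc]
  · intro hlt
    simp only [Exp.eval, Op.eval, h.reg0, hr8, hr9, hr10, hmark] at hlt
    split_ifs at hlt with hlt'
    refine (attach_halts hK hB2 h.reg0 hr8 hr10 hr9 (by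
      change marked n v w m _ + marked n v w m _ + 1 ≤ M
      rw [hmark, hmark]
      omega)).mono le_rfl ?_
    rintro r' m' ⟨rfl, rfl, hB'⟩
    refine ⟨rfl, h.reg0, h.reg1, h.reg3, h.reg5, hB', ?_, hvalid⟩
    refine h.represents.attached_marked ?_ ?_ ⟨w, v, rfl, rfl⟩ hc.2.symm (by omega)
    · rw [Levels.step, if_pos hc]
      simp only [join]
      rw [if_neg (by omega)]
    · rw [Levels.step, if_pos hc]

/-- One bit per pair, telling membership in any forest at all, suffices: an edge of forest `i` or a
later one does not cross at level `i` anyway. -/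
theorem cross_adj_iff (ha : Valid G k a) (v w : Fin n) :
    ((a.rest G i).cross (a.lab i)).Adj v w ↔ G.Adj v w ∧ (¬∃ j, s(v, w) ∈ a.forest j) ∧
      (∀ j < i, a.lab j v = a.lab j w) ∧ a.lab i v ≠ a.lab i w := by
  constructor
  · rintro ⟨⟨h1, h2⟩, h3⟩
    refine ⟨h1, ?_, fun j hj => (h2 j hj).2, h3⟩
    rintro ⟨j, hj⟩
    by_cases hji : j < i
    · exact (h2 j hji).1 hj
    · exact h3 (ha.lab_eq j v w hj i (by omega))
  · rintro ⟨h1, h2, h3, h4⟩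
    exact ⟨⟨h1, fun j hj => ⟨fun hm => h2 ⟨j, hm⟩, h3 j hj⟩⟩, h4⟩

theorem adjQuery_fin (v w : Fin n) : adjQuery L v w = if G.Adj v w then 1 else 0 := by
  simp [adjQuery]

theorem tryEdge_halts (hK : 1000 ≤ K) (hM : M < fuel) (hM2 : 2 ≤ M) (h : Good G k Z M i a r m)
    (hi : i < k) {v w : Fin n} (hr6 : r 6 = v) (hr7 : r 7 = w) :
    Halts L fuel tryEdge ((k + 3) * (4 * n.size + 9) * unit K M) r m fun r' m' =>
      r' 4 = r 4 ∧ Good G k Z M i (a.step G i v w) r' m' := by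
  have hpos : 1 ≤ unit K M := by
    unfold unit
    exact Nat.mul_pos (by omega) (by positivity)
  have hval : (Exp.op .add (.op .eq (.adj (.reg 6) (.reg 7)) (.lit 0))
      (.load (addr 3 (.reg 6) (.reg 7)))).eval L ⟨r, m, 0⟩ =
      (if G.Adj v w then 0 else 1) + if ∃ j, s(v, w) ∈ a.forest j then 1 else 0 := by
    simp only [Exp.eval, addr, Op.eval, h.reg0, hr6, hr7, h.represents.edge, adjQuery_fin]
    split_ifs <;> simp_all
  -- The flag is a sum of two bits, which is why `2 ≤ M` is required; it is 0 exactly for edges of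
  -- `G` in no forest.
  have hD : (if G.Adj v w then 0 else 1) + (if ∃ j, s(v, w) ∈ a.forest j then 1 else 0) ≤ M := by
    split_ifs <;> omega
  refine Halts.seq (T₁ := unit K M) (T₂ := ((i + 1) * (4 * n.size + 7) + (4 * n.size + 8))
    * unit K M) (Halts.assign h.bdd (lt_of_lt_of_le (by simp [Exp.wt, Exp.wid, addr]) hK) ?_) ?_
  swap
  · refine le_trans (le_of_eq (by ring : _ = ((i + 1) * (4 * n.size + 7) + (4 * n.size + 8) + 1)
      * unit K M)) (Nat.mul_le_mul_right _ ?_)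
    have := Nat.mul_le_mul (Nat.succ_le_iff.2 hi) (show 4 * n.size + 7 ≤ 4 * n.size + 9 by omega)
    nlinarith
  rw [hval]
  have hB1 := h.bdd.setReg 11 hD
  set D := (if G.Adj v w then 0 else 1) + if ∃ j, s(v, w) ∈ a.forest j then 1 else 0 with hDdef
  refine Halts.seq (T₁ := (i + 1) * (4 * n.size + 7) * unit K M) (T₂ := (4 * n.size + 8) * unit K M)
    ?_ (le_of_eq (by ring))
  have hc := compareLevels_halts (L := L) hK hM (by omega) hB1 (v := v) (w := w)
    (by simpa using h.reg0) (by simpa using hr6) (by simpa using hr7) h.represents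
  simp only [Function.update_of_ne (show 5 ≠ 11 by decide), h.reg5, Function.update_self] at hc
  refine hc.mono le_rfl ?_
  rintro r₁ m₁ ⟨rfl, g1, g2, g3, g4⟩
  have g4' : ∀ x < 8, r₁ x = r x := fun x hx => by
    rw [g4 x (by omega) (by omega) (by omega) (by omega), Function.update_of_ne (by omega)]
  refine Halts.seq (T₁ := (4 * n.size + 2) * unit K M) (T₂ := 6 * unit K M)
    ((findRoots_halts hK hM g1 (j := i) (v := v) (w := w) ((g4' 0 (by decide)).trans h.reg0) g2
    ((g4' 6 (by decide)).trans hr6) ((g4' 7 (by decide)).trans hr7) h.represents).mono le_rfl ?_)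
    (by rw [← add_mul])
  rintro r₂ m₂ ⟨rfl, e1, e2, e3, e4⟩
  have e4' : ∀ x < 8, r₂ x = r x := fun x hx => by
    rw [e4 x (by omega) (by omega), g4' x hx]
  have hgood : Good G k Z M i a r₂ m₂ :=
    ⟨(e4' 0 (by decide)).trans h.reg0, (e4' 1 (by decide)).trans h.reg1,
      (e4' 3 (by decide)).trans h.reg3, (e4' 5 (by decide)).trans h.reg5, e1, h.represents, h.valid⟩
  have e11 := (e4 11 (by decide) (by decide)).trans g3
  have hiff : (Exp.op .add (.reg 11) (.op .eq (.reg 9) (.reg 10))).eval L ⟨r₂, m₂, 0⟩ = 0 ↔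
      ((a.rest G i).cross (a.lab i)).Adj v w := by
    rw [cross_adj_iff h.valid]
    simp only [Exp.eval, Op.eval, e11, e2, e3, Fin.val_inj, hDdef]
    split_ifs <;> simp_all
  refine Halts.ite (T := 5 * unit K M) e1 (lt_of_lt_of_le (by simp [Exp.wt, Exp.wid]) hK)
    (by nlinarith) ?_ ?_
  · intro h0
    refine Halts.skip (by nlinarith) ⟨e4' 4 (by decide), ?_⟩
    rwa [Levels.step, if_neg (fun hh => h0 (hiff.2 hh))]
  · intro h0
    refine (addEdge_halts hK (by omega) hgood hi ((e4' 6 (by decide)).trans hr6)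
      ((e4' 7 (by decide)).trans hr7) ((e4 8 (by decide) (by decide)).trans g2) e2 e3
      (hiff.1 h0)).mono le_rfl ?_
    rintro r' m' ⟨rfl, hg⟩
    exact ⟨e4' 4 (by decide), hg⟩

end RAM

/-! ### Queries, and the sampling loop matched with `sample`. -/

namespace RAM

open scoped Classical
open SimpleGraph Levels

variable {n : ℕ} {G : SimpleGraph (Fin n)} {L : AdjList G} {k : ℕ} {a : Levels n} {r m : ℕ → ℕ}
  {fuel K M Z i : ℕ}

/-- The forests from level `k` on are empty, so the same single bit decides forest membership for
the certificate. -/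
theorem sdiff_rest_adj_iff (ha : Valid G k a) (v w : Fin n) :
    (G \ a.rest G k).Adj v w ↔ G.Adj v w ∧
      ((∃ j, s(v, w) ∈ a.forest j) ∨ ¬∀ j < k, a.lab j v = a.lab j w) := by
  rw [sdiff_adj]
  refine and_congr_right fun hG => ?_
  constructor
  · intro h
    by_contra! hne
    exact h ⟨hG, fun j hj => ⟨hne.1 j, hne.2 j hj⟩⟩
  · rintro (⟨j, hj⟩ | h) h'
    · have hjk : j < k := by
        by_contra hle
        rw [ha.forest_eq_empty j (by omega)] at hj
        simp at hj
      exact (h'.2 j hjk).1 hj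
    · exact h fun j hj => (h'.2 j hj).2

theorem query_halts (hK : 1000 ≤ K) (hM : M < fuel) (hM1 : 1 ≤ M) (hB : Bdd n M r m)
    (hr : Represents k a m) (ha : Valid G k a) {v w : Fin n} (hr0 : r 0 = v) (hr1 : r 1 = w)
    (hr11 : r 11 = 0) :
    Halts L fuel query ((k + 3) * (4 * n.size + 9) * unit K M) r m fun r' _ =>
      r' 0 = if (G \ a.rest G k).Adj v w then 1 else 0 := by
  have hkM : k ≤ M := hr.levels ▸ hB.mem 4
  have hB1 := hB.setReg 6 (hB.reg 0)
  have hB2 := hB1.setReg 7 (hB.reg 1)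
  have hB3 := hB2.setReg 0 hB.nodes
  have hB4 := hB3.setReg 5 hkM
  refine Halts.seq (T₁ := unit K M) (T₂ := ((k + 1) * (4 * n.size + 7) + 6) * unit K M)
    (Halts.assign hB (lt_of_lt_of_le (by simp [Exp.wt]) hK) ?_) (by
      nlinarith [Nat.zero_le (k * unit K M), Nat.zero_le (n.size * unit K M)])
  simp only [Exp.eval]
  refine Halts.seq (T₁ := unit K M) (T₂ := ((k + 1) * (4 * n.size + 7) + 5) * unit K M)
    (Halts.assign hB1 (lt_of_lt_of_le (by simp [Exp.wt]) hK) ?_) (by nlinarith)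
  simp only [Exp.eval, Function.update_of_ne (show 1 ≠ 6 by decide)]
  refine Halts.seq (T₁ := unit K M) (T₂ := ((k + 1) * (4 * n.size + 7) + 4) * unit K M)
    (Halts.assign hB2 (lt_of_lt_of_le (by simp [Exp.wt, Exp.wid]) hK) ?_) (by nlinarith)
  simp only [Exp.eval, hr.nodes]
  refine Halts.seq (T₁ := unit K M) (T₂ := ((k + 1) * (4 * n.size + 7) + 3) * unit K M)
    (Halts.assign hB3 (lt_of_lt_of_le (by simp [Exp.wt, Exp.wid]) hK) ?_) (by nlinarith)
  simp only [Exp.eval, hr.levels]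
  set r₁ := Function.update (Function.update (Function.update (Function.update r 6 (r 0)) 7 (r 1))
    0 n) 5 k with hr₁
  have e0 : r₁ 0 = n := by simp [hr₁]
  have e5 : r₁ 5 = k := by simp [hr₁]
  have e6 : r₁ 6 = v := by simp [hr₁, hr0]
  have e7 : r₁ 7 = w := by simp [hr₁, hr1]
  have e11 : r₁ 11 = 0 := by simp [hr₁, hr11]
  refine Halts.ite (T := ((k + 1) * (4 * n.size + 7) + 2) * unit K M) hB4
    (lt_of_lt_of_le (by simp [Exp.wt, Exp.wid]) hK) (by nlinarith) ?_ ?_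
  · intro hadj
    simp only [Exp.eval, e6, e7, adjQuery_fin] at hadj
    have hG : G.Adj v w := by
      by_contra hG
      exact hadj (if_neg hG)
    have hmem : (Exp.load (addr 3 (.reg 6) (.reg 7))).eval L ⟨r₁, m, 0⟩ =
        if ∃ j, s(v, w) ∈ a.forest j then 1 else 0 := by
      simp only [Exp.eval, addr, Op.eval, e0, e6, e7, hr.edge]
    refine Halts.ite (T := ((k + 1) * (4 * n.size + 7) + 1) * unit K M) hB4
      (lt_of_lt_of_le (by simp [Exp.wt, Exp.wid, addr]) hK) (by nlinarith) ?_ ?_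
    · intro h1
      rw [hmem] at h1
      have hex : ∃ j, s(v, w) ∈ a.forest j := by
        by_contra hex
        exact h1 (if_neg hex)
      refine (Halts.assign hB4 (lt_of_lt_of_le (by simp [Exp.wt]) hK) ?_).mono
        (by nlinarith [Nat.zero_le ((k + 1) * (4 * n.size + 7) * unit K M)])
        (fun _ _ h => h)
      rw [if_pos ((sdiff_rest_adj_iff ha v w).2 ⟨hG, Or.inl hex⟩)]
      simp [Exp.eval]
    · intro h1
      rw [hmem] at h1
      have hex : ¬∃ j, s(v, w) ∈ a.forest j := by
        intro hex
        rw [if_pos hex] at h1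
        omega
      have hc := compareLevels_halts (L := L) hK hM hM1 hB4 (v := v) (w := w) e0 e6 e7 hr
      rw [e5] at hc
      refine Halts.seq (T₁ := (k + 1) * (4 * n.size + 7) * unit K M) (T₂ := unit K M)
        (hc.mono le_rfl ?_) (by nlinarith)
      rintro r' m' ⟨rfl, h2, -, h3, -⟩
      refine Halts.assign h2 (lt_of_lt_of_le (by simp [Exp.wt]) hK) ?_
      simp only [Exp.eval, h3, e11, Function.update_self, sdiff_rest_adj_iff ha, hG, hex,
        true_and, false_or]
      split_ifs <;> simp_all
  · intro hadj
    simp only [Exp.eval, e6, e7, adjQuery_fin] at hadj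
    have hG : ¬G.Adj v w := by
      intro hG
      rw [if_pos hG] at hadj
      omega
    refine (Halts.assign hB4 (lt_of_lt_of_le (by simp [Exp.wt]) hK) ?_).mono
      (by nlinarith [Nat.zero_le ((k + 1) * (4 * n.size + 7) * unit K M)]) (fun _ _ h => h)
    rw [if_neg fun h => hG ((sdiff_rest_adj_iff ha v w).1 h).1]
    simp [Exp.eval]

theorem isAdjacencyOracle_query (hK : 1000 ≤ K) (hM1 : 1 ≤ M) (hn : n ≤ M) (hm : ∀ i, m i ≤ M)
    (hr : Represents k a m) (ha : Valid G k a) {τ : ℝ}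
    (hτ : (((k + 3) * (4 * n.size + 9) * unit K M : ℕ) : ℝ) ≤ τ) :
    IsAdjacencyOracle L query m τ (G \ a.rest G k) := by
  refine ⟨isQuery_query, fun u v => ⟨M + 1, ?_⟩⟩
  have hB : Bdd n M (fun x => [(u : ℕ), (v : ℕ)].getD x 0) m := by
    refine ⟨hn, fun x => ?_, hm⟩
    rcases x with _ | _ | x
    · exact u.2.le.trans hn
    · exact v.2.le.trans hn
    · simp
  obtain ⟨s, h1, h2, h3⟩ := query_halts (L := L) hK (Nat.lt_succ_self M) hM1 hB hr ha (v := u)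
    (w := v) rfl rfl rfl 0
  refine ⟨s, h1, le_trans ?_ hτ, by convert h3⟩
  rw [zero_add] at h2
  exact_mod_cast h2

theorem Good.setReg (h : Good G k Z M i a r m) {x b : ℕ} (hb : b ≤ M)
    (hx : x ≠ 0 ∧ x ≠ 1 ∧ x ≠ 3 ∧ x ≠ 5) : Good G k Z M i a (Function.update r x b) m where
  reg0 := by rw [Function.update_of_ne hx.1.symm, h.reg0]
  reg1 := by rw [Function.update_of_ne hx.2.1.symm, h.reg1]
  reg3 := by rw [Function.update_of_ne hx.2.2.1.symm, h.reg3]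
  reg5 := by rw [Function.update_of_ne hx.2.2.2.symm, h.reg5]
  bdd := h.bdd.setReg x hb
  represents := h.represents
  valid := h.valid

theorem nbrQuery_fin (v : Fin n) (x : ℕ) : nbrQuery L v x = ((L.nbrs v)[x]?.map Fin.val).getD 0 := by
  simp [nbrQuery]

theorem degQuery_fin (v : Fin n) : degQuery L v = (L.nbrs v).length := by
  simp [degQuery]

theorem processEdge_halts (hK : 1000 ≤ K) (hM : M < fuel) (hM2 : 2 ≤ M) (hn : 0 < n)
    (h : Good G k Z M i a r m) (hi : i < k) {v : Fin n} {x : ℕ} (hr6 : r 6 = v) (hr7 : r 7 = x)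
    (hx : x < (L.nbrs v).length - 1 + 1) :
    Halts L fuel (.seq (.assign 7 (.nbr (.reg 6) (.reg 7)))
      (.seq tryEdge (.assign 4 (.op .sub (.reg 4) (.lit 1)))))
      (((k + 3) * (4 * n.size + 9) + 2) * unit K M) r m fun r' m' =>
      r' 4 = r 4 - 1 ∧ Good G k Z M i ((L.nbrs v)[x]?.elim a (a.step G i v)) r' m' := by
  obtain ⟨w, hw, hstep⟩ : ∃ w : Fin n, nbrQuery L v x = w ∧
      (L.nbrs v)[x]?.elim a (a.step G i v) = a.step G i v w := by
    rw [nbrQuery_fin]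
    rcases hxv : (L.nbrs v)[x]? with _ | w
    -- A failed lookup occurs only at an isolated node. The machine then reads node 0, and since `v`
    -- has no neighbours the pair is rejected.
    · refine ⟨⟨0, hn⟩, rfl, ?_⟩
      have hnil : L.nbrs v = [] := by
        rw [List.getElem?_eq_none_iff] at hxv
        exact List.length_eq_zero_iff.1 (by omega)
      rw [Levels.step, if_neg]
      · rfl
      · intro hc
        have hmem := (L.mem_nbrs v ⟨0, hn⟩).2 hc.1.1
        rw [hnil] at hmem
        exact absurd hmem List.not_mem_nil
    · exact ⟨w, rfl, rfl⟩
  rw [hstep]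
  refine Halts.seq (T₁ := unit K M) (T₂ := ((k + 3) * (4 * n.size + 9) + 1) * unit K M)
    (Halts.assign h.bdd (lt_of_lt_of_le (by simp [Exp.wt, Exp.wid]) hK) ?_) (by nlinarith)
  simp only [Exp.eval, hr6, hr7, hw]
  refine Halts.seq (T₁ := (k + 3) * (4 * n.size + 9) * unit K M) (T₂ := unit K M)
    ((tryEdge_halts hK hM hM2 (h.setReg (x := 7) (w.2.le.trans h.bdd.nodes) (by decide)) hi
      (v := v) (w := w) (by simpa using hr6) (by simp)).mono le_rfl ?_) (by nlinarith)
  rintro r' m' ⟨h4, hg⟩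
  rw [Function.update_of_ne (by decide)] at h4
  refine Halts.assign hg.bdd (lt_of_lt_of_le (by simp [Exp.wt, Exp.wid]) hK) ?_
  simp only [Exp.eval, Op.eval, h4, Function.update_self, true_and]
  exact hg.setReg ((Nat.sub_le _ _).trans (h.bdd.reg 4)) (by decide)

theorem wp_rand_of_eval_eq {x N : ℕ} {e : Exp} {s : State} (he : e.eval L s = N)
    (f : State → ℝ≥0∞) : wp L fuel (.rand x e) f s = ((N - 1 + 1 : ℕ) : ℝ≥0∞)⁻¹ *
      ∑ j : Fin (N - 1 + 1), f ((s.setReg x j).tick (1 + e.cost L s + N.size)) := by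
  subst he
  exact wp_rand x e f s

theorem wp_sampleEdge_le (hK : 1000 ≤ K) (hM : M < fuel) (hM2 : 2 ≤ M) (hn : 0 < n)
    (h : Good G k Z M i a r m) (hi : i < k) {t : ℕ} {f : State → ℝ≥0∞} {ψ : Levels n → ℝ≥0∞}
    (hf : ∀ a' r' m' t', Good G k Z M i a' r' m' → r' 4 = r 4 - 1 →
      t' ≤ t + ((k + 3) * (4 * n.size + 9) + 4) * unit K M → f ⟨r', m', t'⟩ ≤ ψ a') :
    wp L fuel sampleEdge f ⟨r, m, t⟩ ≤ sample L i ψ a := by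
  have hcost : ∀ (e : Exp) (r' m' : ℕ → ℕ) (t' : ℕ) (b : ℕ), Bdd n M r' m' → b ≤ M → e.wt < 998 →
      1 + e.cost L ⟨r', m', t'⟩ + b.size ≤ unit K M := by
    intro e r' m' t' b hB hb he
    have h1 := Exp.cost_le L ⟨r', m', t'⟩ hB e
    have h2 := Nat.size_le_size hb
    have h3 : M.size + 1 ≤ (M.size + 1) ^ 2 := by nlinarith
    have h4 : (e.wt + 1) * (M.size + 1) ^ 2 ≤ unit K M := Nat.mul_le_mul_right _ (by omega)
    nlinarith
  -- The range of the draw is a type depending on `N`; stating the equation for a variable `N`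
  -- permits the substitution.
  have key : ∀ N : ℕ, N = n → ∀ F : ℕ → ℝ≥0∞,
      (N : ℝ≥0∞)⁻¹ * ∑ j : Fin N, F j = (n : ℝ≥0∞)⁻¹ * ∑ j : Fin n, F j := by
    rintro N rfl F
    rfl
  rw [sampleEdge, wp_seq, wp_rand_of_eval_eq (e := .reg 0) (s := ⟨r, m, t⟩) h.reg0,
    key _ (Nat.sub_add_cancel hn) fun j => wp L fuel _ f
      (((⟨r, m, t⟩ : State).setReg 6 j).tick (1 + (Exp.reg 0).cost L ⟨r, m, t⟩ + n.size)), sample]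
  refine mul_le_mul_right (Finset.sum_le_sum fun v _ => ?_) _
  set t₁ := 1 + (Exp.reg 0).cost L ⟨r, m, t⟩ + n.size with ht₁
  have ht₁' : t₁ ≤ unit K M := hcost _ _ _ _ _ h.bdd h.bdd.nodes (by simp [Exp.wt])
  have h1 := h.setReg (x := 6) (v.2.le.trans h.bdd.nodes) (by decide)
  rw [wp_seq, wp_rand_of_eval_eq (N := (L.nbrs v).length)]
  swap
  · simp [Exp.eval, State.tick, State.setReg, degQuery_fin]
  refine mul_le_mul_right (Finset.sum_le_sum fun x _ => ?_) _
  have hlen : (L.nbrs v).length ≤ M := (degQuery_fin (L := L) v ▸ degQuery_le L v).trans h.bdd.nodes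
  have hxM : (x : ℕ) ≤ M := by
    have := x.2
    omega
  have h2 := h1.setReg (x := 7) hxM (by decide)
  have ht₂ := hcost (.deg (.reg 6)) _ _ (t + t₁) _ h1.bdd hlen (by simp [Exp.wt, Exp.wid])
  refine (processEdge_halts hK hM hM2 hn h2 hi (v := v) (x := x) (by simp) (by simp) x.2).wp_le
    fun r' m' t' ht' hg => hf _ _ _ _ hg.2 (by simpa using hg.1) ?_
  refine ht'.trans ?_
  have : t + t₁ + (1 + (Exp.deg (.reg 6)).cost L ⟨Function.update r 6 v, m, t + t₁⟩ +
      (L.nbrs v).length.size) + ((k + 3) * (4 * n.size + 9) + 2) * unit K M ≤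
      t + ((k + 3) * (4 * n.size + 9) + 4) * unit K M := by nlinarith
  exact this

theorem exists_of_iInf_iInf_ne_top {α : Type*} {P : α → Prop} {f : α → ℝ≥0∞}
    (h : (⨅ x, ⨅ (_ : P x), f x) ≠ ⊤) : ∃ x, P x := by
  by_contra! hne
  exact h (by simp [hne])

theorem wp_sampleEdges_le (hK : 1000 ≤ K) (hM : M < fuel) (hM2 : 2 ≤ M) (hn : 0 < n)
    (h : Good G k Z M i a r m) (hi : i < k) {t T : ℕ} {f : State → ℝ≥0∞} {ψ : Levels n → ℝ≥0∞}
    (hf : ∀ a' r' m' t', Good G k Z M i a' r' m' → t' ≤ T → f ⟨r', m', t'⟩ ≤ ψ a')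
    (ht : t + (r 4 * ((k + 3) * (4 * n.size + 9) + 5) + 1) * unit K M ≤ T) :
    wp L fuel (.loop (.reg 4) sampleEdge) f ⟨r, m, t⟩ ≤ (sample L i)^[r 4] ψ a := by
  set c := (k + 3) * (4 * n.size + 9) + 4 with hc
  have hcost : ∀ s : State, Bdd n M s.reg s.mem → 1 + (Exp.reg 4).cost L s ≤ unit K M :=
    fun s hB => one_add_cost_le (r := s.reg) (m := s.mem) s.time hB
      (lt_of_lt_of_le (by simp [Exp.wt]) hK)
  -- The levels are not part of the machine state, so the potential takes the infimum over all
  -- levels that the state may represent in time; without any, it is `⊤`.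
  refine (wp_loop (J := fun j s => ⨅ b, ⨅ (_ : Good G k Z M i b s.reg s.mem ∧ s.reg 4 = j ∧
    s.time + (j * (c + 1) + 1) * unit K M ≤ T), (sample L i)^[j] ψ b) ?_ ?_
    ((h.bdd.reg 4).trans_lt hM) _).trans (iInf₂_le a ⟨h, rfl, ht⟩)
  · intro j s _ h0
    refine le_iInf₂ fun b hb => ?_
    obtain ⟨hb, hj, hT⟩ := hb
    have hj0 : j = 0 := hj ▸ h0
    subst hj0
    refine hf b _ _ _ hb ?_
    have := hcost s hb.bdd
    omega
  · intro j s hne h0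
    obtain ⟨b, hb, hj, -⟩ := exists_of_iInf_iInf_ne_top hne
    obtain ⟨j, rfl⟩ : ∃ j', j = j' + 1 := Nat.exists_eq_succ_of_ne_zero (hj ▸ h0)
    refine ⟨j, rfl, le_iInf₂ fun b hb => ?_⟩
    obtain ⟨hb, hj, hT⟩ := hb
    rw [Function.iterate_succ_apply']
    refine wp_sampleEdge_le hK hM hM2 hn hb hi fun a' r' m' t' ha' h4 ht' => ?_
    refine iInf₂_le a' ⟨ha', h4.trans (by rw [hj]; rfl), ?_⟩
    have := hcost s hb.bdd
    rw [← hc] at ht'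
    dsimp only
    nlinarith

/-- Build the levels one after the other, each with the number of samples in register 3. -/
def buildLevels : Prog :=
  .loop (.op .lt (.reg 5) (.reg 1)) (.seq (.assign 4 (.reg 3))
    (.seq (.loop (.reg 4) sampleEdge) (.assign 5 (.op .add (.reg 5) (.lit 1)))))

/-- The potential is `failure` at the current level, again minimized over the represented levels;
`sample_iterate_failure_le` is the step from one level to the next. -/
theorem wp_buildLevels_le (hK : 1000 ≤ K) (hM : M < fuel) (hM2 : 2 ≤ M) (hn : 0 < n)
    {e c : ℕ} (he : 1 ≤ e) (hZ : Z = n * (4 * k * e + 2) * (k * n ^ (c + 1)).size)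
    (h : Good G k Z M i a r m) (hi : i ≤ k) {t T : ℕ} {f : State → ℝ≥0∞}
    (hf : ∀ a' r' m' t', Good G k Z M k a' r' m' → t' ≤ T →
      f ⟨r', m', t'⟩ ≤ failure G e k (1 / (k * n ^ c : ℕ)) k a')
    (ht : t + ((k - i) * (Z * ((k + 3) * (4 * n.size + 9) + 5) + 4) + 1) * unit K M ≤ T) :
    wp L fuel buildLevels f ⟨r, m, t⟩ ≤ failure G e k (1 / (k * n ^ c : ℕ)) i a := by
  set d := (k + 3) * (4 * n.size + 9) + 5 with hd
  set β : ℝ := 1 / (k * n ^ c : ℕ) with hβ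
  have hcost : ∀ s : State, Bdd n M s.reg s.mem →
      1 + (Exp.op .lt (.reg 5) (.reg 1)).cost L s ≤ unit K M :=
    fun s hB => one_add_cost_le (r := s.reg) (m := s.mem) s.time hB
      (lt_of_lt_of_le (by simp [Exp.wt, Exp.wid]) hK)
  refine (wp_loop (J := fun j s => ⨅ x : Levels n × ℕ,
    ⨅ (_ : x.2 + j = k ∧ Good G k Z M x.2 x.1 s.reg s.mem ∧
      s.time + (j * (Z * d + 4) + 1) * unit K M ≤ T), failure G e k β x.2 x.1) ?_ ?_
    (j := k - i) ?_ _).trans (iInf₂_le (a, i) ⟨by dsimp only; omega, h, ht⟩)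
  · rintro j s - h0
    refine le_iInf₂ fun ⟨b, i'⟩ hb => ?_
    obtain ⟨hj, hb, hT⟩ := hb
    dsimp only at hj hb hT ⊢
    have hik : i' = k := by
      simp only [Exp.eval, Op.eval, hb.reg5, hb.reg1] at h0
      split_ifs at h0
      omega
    subst hik
    refine hf b _ _ _ hb ?_
    have := hcost s hb.bdd
    have hj0 : j = 0 := by omega
    subst hj0
    omega
  · intro j s hne h0
    obtain ⟨⟨b, i'⟩, hj, hb, -⟩ := exists_of_iInf_iInf_ne_top hne
    dsimp only at hj hb
    have hik : ∀ i' b, Good G k Z M i' b s.reg s.mem → i' < k := fun i' b hb => by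
      simp only [Exp.eval, Op.eval, hb.reg5, hb.reg1] at h0
      split_ifs at h0 with h
      · exact h
      · exact absurd rfl h0
    have := hik i' b hb
    refine ⟨j - 1, by omega, le_iInf₂ fun ⟨b, i'⟩ hb => ?_⟩
    obtain ⟨hj, hb, hT⟩ := hb
    dsimp only at hj hb hT ⊢
    have hi' := hik i' b hb
    have hj1 : j = j - 1 + 1 := by omega
    refine le_trans ?_ (sample_iterate_failure_le L hi' he hn c hb.valid)
    rw [← hZ, ← hβ, wp_seq]
    have hZM : Z ≤ M := hb.reg3 ▸ hb.bdd.reg 3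
    have hb4 : Good G k Z M i' b (Function.update s.reg 4 Z) s.mem :=
      hb.setReg hZM (by decide)
    refine (Halts.assign (K := K) (Q := fun r' m' => r' = Function.update s.reg 4 Z ∧ m' = s.mem)
      hb.bdd (lt_of_lt_of_le (by simp [Exp.wt]) hK) ?_).wp_le ?_
    · simp only [Exp.eval, hb.reg3]
      exact ⟨trivial, trivial⟩
    rintro r' m' t' ht' ⟨rfl, rfl⟩
    rw [wp_seq]
    have hloop := wp_sampleEdges_le (L := L) (t := t') (T := t' + (Z * d + 1) * unit K M) hK hM hM2
      hn hb4 hi' (ψ := failure G e k β (i' + 1))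
      (f := wp L fuel (.assign 5 (.op .add (.reg 5) (.lit 1)))
        fun s => ⨅ x : Levels n × ℕ, ⨅ (_ : x.2 + (j - 1) = k ∧ Good G k Z M x.2 x.1 s.reg s.mem ∧
          s.time + ((j - 1) * (Z * d + 4) + 1) * unit K M ≤ T), failure G e k β x.2 x.1) ?_
      (by rw [Function.update_self])
    · rwa [Function.update_self] at hloop
    intro a' r' m' t'' hg ht''
    have hkM : k ≤ M := hg.reg1 ▸ hg.bdd.reg 1
    refine (Halts.assign (K := K) (Q := fun r₁ m₁ => r₁ = Function.update r' 5 (i' + 1) ∧ m₁ = m')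
      hg.bdd (lt_of_lt_of_le (by simp [Exp.wt, Exp.wid]) hK) ?_).wp_le ?_
    · simp only [Exp.eval, Op.eval, hg.reg5]
      exact ⟨trivial, trivial⟩
    rintro r₁ m₁ t₁ ht₁ ⟨rfl, rfl⟩
    refine iInf₂_le (a', i' + 1) ⟨by dsimp only; omega, ?_, ?_⟩
    · exact ⟨by simpa using hg.reg0, by simpa using hg.reg1, by simpa using hg.reg3, by simp,
        hg.bdd.setReg 5 (by omega), hg.represents, hg.valid⟩
    · have := hcost s hb.bdd
      rw [hj1] at hT
      dsimp only
      nlinarith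
  · have hkM : k ≤ M := h.reg1 ▸ h.bdd.reg 1
    omega

end RAM

/-! ### The complete preprocessing. -/

namespace RAM

open scoped Classical
open SimpleGraph Levels

variable {n : ℕ} {G : SimpleGraph (Fin n)} {L : AdjList G} {k : ℕ} {a : Levels n} {r m : ℕ → ℕ}
  {fuel K M Z i : ℕ}

/-- `k * n ^ c`, where `k` and `n` are held by registers 1 and 0. -/
def powExp : ℕ → Exp
  | 0 => .reg 1
  | c + 1 => .op .mul (powExp c) (.reg 0)

theorem eval_powExp (s : State) (c : ℕ) : (powExp c).eval L s = s.reg 1 * s.reg 0 ^ c := by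
  induction c with
  | zero => simp [powExp, Exp.eval]
  | succ c ih => simp [powExp, Exp.eval, Op.eval, ih, pow_succ, mul_assoc]

/-- Add the number of samples for one halving of the failure probability to register 3, as many
times as the number in register 4 has digits. -/
def countSamples : Prog :=
  .loop (.reg 4) (.seq
    (.assign 3 (.op .add (.reg 3) (.op .mul (.reg 0)
      (.op .add (.op .mul (.op .mul (.lit 4) (.reg 1)) (.reg 2)) (.lit 2)))))
    (.assign 4 (.op .div (.reg 4) (.lit 2))))

/-- The preprocessing, with failure probability `1 / n ^ c`. -/
def prepare (c : ℕ) : Prog :=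
  .seq (.ite (.op .lt (.reg 0) (.reg 2)) (.assign 2 (.reg 0)) .skip)
    (.seq (.store (.lit 0) (.reg 0)) (.seq (.store (.lit 4) (.reg 1))
      (.seq (.assign 4 (powExp (c + 1))) (.seq countSamples buildLevels))))

theorem size_div_two_add_one {x : ℕ} (hx : x ≠ 0) : (x / 2).size + 1 = x.size := by
  -- Halving shifts the digits; evaluating this equivalence at the ends of the two ranges determines
  -- both sizes.
  have h1 : ∀ j, j < (x / 2).size ↔ j + 1 < x.size := fun j => by
    rw [Nat.lt_size, Nat.lt_size, pow_succ, Nat.le_div_iff_mul_le (by norm_num)]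
  have h2 : 0 < x.size := Nat.size_pos.2 (Nat.pos_of_ne_zero hx)
  have h3 := h1 (x / 2).size
  have h4 := h1 (x.size - 1)
  have h5 := h1 (x.size - 2)
  omega

theorem countSamples_halts (hK : 1000 ≤ K) (hM : M < fuel) (hB : Bdd n M r m) (hr3 : r 3 = 0)
    (hZ : r 0 * (4 * r 1 * r 2 + 2) * (r 4).size ≤ M) :
    Halts L fuel countSamples ((3 * (r 4).size + 1) * unit K M) r m fun r' m' =>
      m' = m ∧ Bdd n M r' m ∧ r' 3 = r 0 * (4 * r 1 * r 2 + 2) * (r 4).size ∧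
        ∀ x, x ≠ 3 → x ≠ 4 → r' x = r x := by
  set T := r 0 * (4 * r 1 * r 2 + 2) with hT
  have hsz : (r 4).size ≤ r 4 := Nat.size_le.2 Nat.lt_two_pow_self
  refine Halts.loop (K := K) (M := M) (T := 2 * unit K M) (j := (r 4).size)
    (I := fun j r' m' => m' = m ∧ Bdd n M r' m ∧ (r' 4).size = j ∧
      r' 3 + T * (r' 4).size = T * (r 4).size ∧ ∀ x, x ≠ 3 → x ≠ 4 → r' x = r x) ?_ ?_ ?_ ?_ ?_ ?_ ?_
  · exact lt_of_lt_of_le (by simp [Exp.wt]) hK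
  · have := hB.reg 4
    omega
  · nlinarith
  · exact ⟨rfl, hB, rfl, by rw [hr3, zero_add], fun _ _ _ => rfl⟩
  · rintro j r' m' ⟨rfl, h, -⟩
    exact h
  · rintro j r' m' ⟨rfl, h1, h2, h3, h4⟩ h0
    simp only [Exp.eval] at h0
    rw [h0, Nat.size_zero, mul_zero, add_zero] at h3
    exact ⟨rfl, h1, h3, h4⟩
  · rintro j r' m' ⟨rfl, h1, h2, h3, h4⟩ h0
    simp only [Exp.eval] at h0
    have hsize := size_div_two_add_one h0
    have h3' : r' 3 + T + T * (r' 4 / 2).size = T * (r 4).size := by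
      rw [← h3, ← hsize]
      ring
    have hval : (Exp.op .add (.reg 3) (.op .mul (.reg 0)
      (.op .add (.op .mul (.op .mul (.lit 4) (.reg 1)) (.reg 2)) (.lit 2)))).eval L
        ⟨r', m', 0⟩ = r' 3 + T := by
      simp only [Exp.eval, Op.eval, h4 0 (by decide) (by decide), h4 1 (by decide) (by decide),
        h4 2 (by decide) (by decide), hT]
    have h1' : Bdd n M (Function.update r' 3 (r' 3 + T)) m' := h1.setReg 3 (by omega)
    refine ⟨j - 1, by omega, Halts.seq (T₁ := unit K M) (T₂ := unit K M)
      (Halts.assign h1 (lt_of_lt_of_le (by simp [Exp.wt, Exp.wid]) hK) ?_) (by omega)⟩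
    rw [hval]
    refine Halts.assign h1' (lt_of_lt_of_le (by simp [Exp.wt, Exp.wid]) hK) ?_
    simp only [Exp.eval, Op.eval, Function.update_of_ne (show 4 ≠ 3 by decide)]
    refine ⟨trivial, h1'.setReg 4 ((Nat.div_le_self _ _).trans (h1.reg 4)), ?_, ?_, ?_⟩
    · rw [Function.update_self]
      omega
    · rw [Function.update_self, Function.update_of_ne (by decide), Function.update_self, h3']
    · intro x x3 x4
      rw [Function.update_of_ne x4, Function.update_of_ne x3, h4 x x3 x4]

/-- A bound for all numbers that occur in the preprocessing and the queries. -/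
def bound (n k c : ℕ) : ℕ := n * (4 * k * n + 2) * (k * n ^ (c + 1))

/-- A bound for the time of the preprocessing. -/
def totalTime (K n k e c : ℕ) : ℕ :=
  2 * unit K (max (bound n k c) e) + (3 * (k * n ^ (c + 1)).size + 5 +
    k * (n * (4 * k * min e n + 2) * (k * n ^ (c + 1)).size * ((k + 3) * (4 * n.size + 9) + 5) + 4))
      * unit K (bound n k c)

/-- Only the initial conditional handles `e` itself, at the larger unit cost. Afterwards register 2
is capped at `n`, and all numbers are at most `bound n k c`, however small `ε` is. -/
theorem wp_prepare_le {e c : ℕ} (hn : 0 < n) (hk : 0 < k) (he : 0 < e)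
    (hK : 1000 + (powExp (c + 1)).wt ≤ K) {f : State → ℝ≥0∞}
    (hf : ∀ Z a' r' m' t', Good G k Z (bound n k c) k a' r' m' → t' ≤ totalTime K n k e c →
      f ⟨r', m', t'⟩ ≤ failure G (min e n) k (1 / (k * n ^ c : ℕ)) k a') :
    wp L (bound n k c + 1) (prepare c) f (State.init [n, k, e] fun _ => 0) ≤ 1 / (n : ℝ≥0∞) ^ c := by
  have hK' : 1000 ≤ K := by omega
  set M := bound n k c with hMdef
  set y := k * n ^ (c + 1) with hy
  set e' := min e n with he'def
  have he' : 1 ≤ e' := by omega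
  have hy0 : 0 < y := by positivity
  have hyy : y.size ≤ y := Nat.size_le.2 Nat.lt_two_pow_self
  have hT0 : 0 < n * (4 * k * n + 2) := by positivity
  have hyM : y ≤ M := Nat.le_mul_of_pos_left y hT0
  have hTM : n * (4 * k * n + 2) ≤ M := Nat.le_mul_of_pos_right _ hy0
  have hM2 : 2 ≤ M := by nlinarith [Nat.mul_pos hk hn, Nat.mul_pos (Nat.mul_pos hk hn) hn]
  have hnM : n ≤ M := (Nat.le_mul_of_pos_right n (by positivity)).trans hTM
  have hkM : k ≤ M := (Nat.le_mul_of_pos_right k (by positivity)).trans hyM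
  have hZM : n * (4 * k * e' + 2) * y.size ≤ M := by
    rw [hMdef, bound]
    gcongr
    exact min_le_right _ _
  set r₀ : ℕ → ℕ := fun x => [n, k, e].getD x 0 with hr₀
  set r₁ : ℕ → ℕ := fun x => [n, k, e'].getD x 0 with hr₁
  have hB₀ : Bdd n (max M e) r₀ fun _ => 0 := by
    refine ⟨by omega, fun x => ?_, fun _ => Nat.zero_le _⟩
    rcases x with _ | _ | _ | x
    · exact hnM.trans (le_max_left _ _)
    · exact hkM.trans (le_max_left _ _)
    · exact le_max_right _ _
    · exact Nat.zero_le _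
  have hB₁ : Bdd n M r₁ fun _ => 0 := by
    refine ⟨by omega, fun x => ?_, fun _ => Nat.zero_le _⟩
    rcases x with _ | _ | _ | x
    · exact hnM
    · exact hkM
    · exact (min_le_right e n).trans hnM
    · exact Nat.zero_le _
  have hpos : 1 ≤ unit K (max M e) := by
    unfold unit
    exact Nat.mul_pos (by omega) (by positivity)
  rw [prepare, wp_seq]
  refine (Halts.ite (K := K) (M := max M e) (T := unit K (max M e)) (T' := 2 * unit K (max M e))
    (Q := fun r m => r = r₁ ∧ m = fun _ => 0) (r := r₀) (m := fun _ => 0) hB₀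
    (lt_of_lt_of_le (by simp [Exp.wt, Exp.wid]) hK') (by omega) ?_ ?_).wp_le (t := 0) ?_
  · intro h
    have hlt : n < e := by
      by_contra hge
      exact h (if_neg hge)
    refine Halts.assign hB₀ (lt_of_lt_of_le (by simp [Exp.wt]) hK') ⟨?_, rfl⟩
    funext x
    rcases x with _ | _ | _ | x
    · rfl
    · rfl
    · exact (min_eq_right hlt.le).symm
    · rfl
  · intro h
    have hge : e ≤ n := by
      by_contra hlt
      rw [not_le] at hlt
      have : (1 : ℕ) = 0 := (if_pos hlt).symm.trans h
      omega
    refine Halts.skip hpos ⟨?_, rfl⟩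
    rw [hr₀, hr₁, he'def, min_eq_left hge]
  rintro r m t₁ ht₁ ⟨rfl, rfl⟩
  rw [wp_seq]
  have hB₂ := hB₁.setMem 0 hnM
  refine (Halts.store (K := K) (Q := fun r m => r = r₁ ∧ m = Function.update (fun _ => 0) 0 n)
    hB₁ (lt_of_lt_of_le (by simp [Exp.wt, Exp.wid]) hK') ⟨rfl, rfl⟩).wp_le ?_
  rintro r m t₂ ht₂ ⟨rfl, rfl⟩
  rw [wp_seq]
  have hB₃ := hB₂.setMem 4 hkM
  refine (Halts.store (K := K) (Q := fun r m => r = r₁ ∧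
    m = Function.update (Function.update (fun _ => 0) 0 n) 4 k)
    hB₂ (lt_of_lt_of_le (by simp [Exp.wt, Exp.wid]) hK') ⟨rfl, rfl⟩).wp_le ?_
  rintro r m t₃ ht₃ ⟨rfl, rfl⟩
  rw [wp_seq]
  have hB₄ := hB₃.setReg 4 hyM
  refine (Halts.assign (K := K) (Q := fun r m => r = Function.update r₁ 4 y ∧
    m = Function.update (Function.update (fun _ => 0) 0 n) 4 k)
    hB₃ (lt_of_lt_of_le (by omega) hK) ⟨by rw [eval_powExp]; rfl, rfl⟩).wp_le ?_
  rintro r m t₄ ht₄ ⟨rfl, rfl⟩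
  rw [wp_seq]
  refine (countSamples_halts (K := K) hK' (Nat.lt_succ_self M) hB₄ (by simp [hr₁]) (by
    simpa [hr₁] using hZM)).wp_le ?_
  rintro r m t₅ ht₅ ⟨rfl, hB₅, hr3, hr⟩
  have hgood : Good G k (n * (4 * k * e' + 2) * y.size) M 0 (start n) r
      (Function.update (Function.update (fun _ => 0) 0 n) 4 k) := by
    refine ⟨?_, ?_, ?_, ?_, hB₅, represents_start, valid_start⟩
    · rw [hr 0 (by decide) (by decide)]; simp [hr₁]
    · rw [hr 1 (by decide) (by decide)]; simp [hr₁]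
    · rw [hr3]; simp [hr₁]
    · rw [hr 5 (by decide) (by decide)]; simp [hr₁]
  refine (wp_buildLevels_le hK' (Nat.lt_succ_self M) hM2 hn he' rfl hgood (Nat.zero_le k)
    (T := totalTime K n k e c) (fun a' r' m' t' => hf _ a' r' m' t') ?_).trans ?_
  · rw [totalTime, ← hMdef, ← hy, ← he'def]
    rw [Function.update_self] at ht₅
    simp only [Nat.sub_zero]
    nlinarith
  · have hs0 : Sparse G e' 0 (start n) := fun j hj => absurd hj (Nat.not_lt_zero j)
    unfold Levels.failure
    rw [if_pos hs0]
    have hkR : (k : ℝ) ≠ 0 := by exact_mod_cast hk.ne'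
    have hncR : (0 : ℝ) < (n : ℝ) ^ c := by positivity
    have h1 : ((k - 0 : ℕ) : ℝ) * (1 / (k * n ^ c : ℕ)) = 1 / (n : ℝ) ^ c := by
      push_cast
      rw [Nat.sub_zero]
      field_simp
    rw [h1, ENNReal.ofReal_div_of_pos hncR, ENNReal.ofReal_one,
      ENNReal.ofReal_pow (Nat.cast_nonneg n), ENNReal.ofReal_natCast]

end RAM

/-! ### Asymptotic estimates of the running time. -/

namespace RAM

theorem size_mul_le (x y : ℕ) : (x * y).size ≤ x.size + y.size := by
  rw [Nat.size_le, pow_add]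
  exact Nat.mul_lt_mul'' (Nat.lt_size_self x) (Nat.lt_size_self y)

theorem size_pow_le (x c : ℕ) : (x ^ (c + 1)).size ≤ (c + 1) * x.size := by
  induction c with
  | zero => simp
  | succ c ih =>
    rw [pow_succ]
    have := size_mul_le (x ^ (c + 1)) x
    nlinarith

theorem size_le_two_mul_log {n : ℕ} (hn : 0 < n) : (n.size : ℝ) ≤ 2 * (1 + Real.log n) := by
  have h1 : 0 < n.size := Nat.size_pos.2 hn
  have h2 : 2 ^ (n.size - 1) ≤ n := Nat.lt_size.1 (by omega)
  have h3 : ((2 : ℝ) ^ (n.size - 1)) ≤ n := by exact_mod_cast h2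
  have h4 := Real.log_le_log (by positivity) h3
  rw [Real.log_pow, Nat.cast_sub h1] at h4
  push_cast at h4
  have h5 := Real.log_two_gt_d9
  have h6 : (1 : ℝ) ≤ n.size := by exact_mod_cast h1
  nlinarith

/-- Reading and comparing `⌈1 / ε⌉` costs quadratically many steps in its digits; this fits into the
factor `max 1 (1 / ε)` of the time bound, which matters as `ε` is not bounded below in terms of `n`.
-/
theorem size_sq_le (e : ℕ) : e.size ^ 2 ≤ 4 * e := by
  have key : ∀ s : ℕ, (s + 1) ^ 2 ≤ 4 * 2 ^ s := by
    intro s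
    induction s with
    | zero => norm_num
    | succ s ih =>
      rcases s with _ | _ | s
      · norm_num
      · norm_num
      · rw [pow_succ 2 (s + 1 + 1)]
        nlinarith [Nat.zero_le (s * s), Nat.zero_le s]
  rcases Nat.eq_zero_or_pos e with rfl | he
  · simp
  · have h1 : 0 < e.size := Nat.size_pos.2 he
    have h2 : 2 ^ (e.size - 1) ≤ e := Nat.lt_size.1 (by omega)
    have h3 := key (e.size - 1)
    rw [Nat.sub_add_cancel h1] at h3
    omega

theorem size_bound_le {n k : ℕ} (c : ℕ) (hn : 0 < n) (hk : 0 < k) :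
    (k * n ^ (c + 1)).size ≤ k + (c + 1) * n.size ∧
      (bound n k c).size ≤ 2 * k + (c + 3) * n.size + 3 := by
  have hk' : k.size ≤ k := Nat.size_le.2 Nat.lt_two_pow_self
  have h1 := size_mul_le k (n ^ (c + 1))
  have h2 := size_pow_le n c
  have h3 := size_mul_le (n * (4 * k * n + 2)) (k * n ^ (c + 1))
  have h4 := size_mul_le n (4 * k * n + 2)
  have h5 : (4 * k * n + 2).size ≤ (6 * (k * n)).size :=
    Nat.size_le_size (by nlinarith [Nat.mul_pos hk hn])
  have h6 := size_mul_le 6 (k * n)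
  have h7 := size_mul_le k n
  have h8 : (6 : ℕ).size ≤ 3 := Nat.size_le.2 (by norm_num)
  unfold bound
  constructor
  · omega
  · have : (c + 3) * n.size = (c + 1) * n.size + 2 * n.size := by ring
    omega

theorem unit_max_le (K M e : ℕ) : unit K (max M e) ≤ 2 * unit K M + 8 * K * e := by
  have h1 : (max M e).size ≤ M.size + e.size := by
    rcases max_cases M e with ⟨h, -⟩ | ⟨h, -⟩ <;> rw [h] <;> omega
  have h2 : ((max M e).size + 1) ^ 2 ≤ 2 * (M.size + 1) ^ 2 + 8 * e := by
    have h3 := size_sq_le e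
    have h4 : ((max M e).size + 1) ^ 2 ≤ (M.size + 1 + e.size) ^ 2 :=
      Nat.pow_le_pow_left (by omega) 2
    zify at *
    nlinarith [sq_nonneg ((M.size : ℤ) + 1 - e.size)]
  unfold unit
  calc _ ≤ K * (2 * (M.size + 1) ^ 2 + 8 * e) := Nat.mul_le_mul_left K h2
    _ = _ := by ring

set_option maxHeartbeats 1000000 in
/-- If `k` is polylogarithmic in `n`, then so is the time of a query, and that of the preprocessing
is `n * max 1 (1 / ε)` up to a polylogarithmic factor. -/
theorem exists_time_bound (K c a : ℕ) : ∃ C : ℕ, ∀ (n k : ℕ) (ε : ℝ), 0 < n → 1 ≤ k →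
    (k : ℝ) ≤ a * (1 + Real.log n) ^ a → 0 < ε →
    (((k + 3) * (4 * n.size + 9) * unit K (bound n k c) : ℕ) : ℝ) ≤ C * (1 + Real.log n) ^ C ∧
    (totalTime K n k ⌈1 / ε⌉₊ c : ℝ) ≤ C * (n * max 1 (1 / ε)) * (1 + Real.log n) ^ C := by
  -- With `l = 1 + log n`, `D` bounds the digits of `bound n k c`, plus one, in multiples of `l ^ (a
  -- + 1)`. `A` is the factor of the sampling work, while `C₁` and `C₂` are the factors for queries
  -- and preprocessing.
  obtain ⟨D, hD⟩ : ∃ D : ℕ, D = 2 * a + 2 * c + 10 := ⟨_, rfl⟩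
  obtain ⟨A, hA⟩ : ∃ A : ℕ, A = a * (8 * a + 2) * (a + 2 * c + 2) * (17 * a + 56) := ⟨_, rfl⟩
  obtain ⟨C₁, hC₁⟩ : ∃ C₁ : ℕ, C₁ = 17 * (a + 3) * (K * D ^ 2) := ⟨_, rfl⟩
  obtain ⟨C₂, hC₂⟩ : ∃ C₂ : ℕ, C₂ = 4 * (K * D ^ 2) + 32 * K +
    (3 * (a + 2 * c + 2) + 5 + A + 4 * a) * (K * D ^ 2) := ⟨_, rfl⟩
  -- The same constant must serve as factor and as exponent. The exponent `6 * a + 4` is `4 * a + 2`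
  -- from the number of steps plus `2 * a + 2` from the unit cost; queries need only `3 * a + 3`.
  refine ⟨C₁ + C₂ + (6 * a + 4), fun n k ε hn hk hka hε => ?_⟩
  set l : ℝ := 1 + Real.log n with hl
  set X : ℝ := max 1 (1 / ε) with hX
  have hl1 : 1 ≤ l := by
    have := Real.log_nonneg (show (1 : ℝ) ≤ n by exact_mod_cast hn)
    linarith
  have hl0 : 0 ≤ l := by linarith
  have hX1 : 1 ≤ X := le_max_left _ _
  have hn1 : (1 : ℝ) ≤ n := by exact_mod_cast hn
  have hnX : 1 ≤ n * X := by nlinarith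
  have mono : ∀ {p q : ℕ}, p ≤ q → l ^ p ≤ l ^ q := fun h => pow_le_pow_right₀ hl1 h
  have one : ∀ p : ℕ, 1 ≤ l ^ p := fun p => one_le_pow₀ hl1
  have hsn : (n.size : ℝ) ≤ 2 * l := size_le_two_mul_log hn
  have hl' : l ≤ l ^ (a + 1) := by simpa using mono (show 1 ≤ a + 1 by omega)
  have hk' : (k : ℝ) ≤ a * l ^ (a + 1) :=
    hka.trans (mul_le_mul_of_nonneg_left (mono (by omega)) (Nat.cast_nonneg a))
  obtain ⟨hy, hM⟩ := size_bound_le c hn hk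
  have hyR : ((k * n ^ (c + 1)).size : ℝ) ≤ (a + 2 * c + 2) * l ^ (a + 1) := by
    have h1 : ((k * n ^ (c + 1)).size : ℝ) ≤ k + (c + 1) * n.size := by exact_mod_cast hy
    have h2 : ((c : ℝ) + 1) * n.size ≤ (c + 1) * (2 * l ^ (a + 1)) :=
      mul_le_mul_of_nonneg_left (by linarith) (by positivity)
    linarith
  have hMR : ((bound n k c).size : ℝ) + 1 ≤ D * l ^ (a + 1) := by
    have h1 : ((bound n k c).size : ℝ) ≤ 2 * k + (c + 3) * n.size + 3 := by exact_mod_cast hM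
    have h2 : ((c : ℝ) + 3) * n.size ≤ (c + 3) * (2 * l ^ (a + 1)) :=
      mul_le_mul_of_nonneg_left (by linarith) (by positivity)
    have h3 := one (a + 1)
    rw [hD]
    push_cast
    linarith
  have hU : (unit K (bound n k c) : ℝ) ≤ K * D ^ 2 * l ^ (2 * a + 2) := by
    unfold unit
    push_cast
    have h1 := pow_le_pow_left₀ (by positivity) hMR 2
    calc (K : ℝ) * ((bound n k c).size + 1) ^ 2 ≤ K * (D * l ^ (a + 1)) ^ 2 :=
          mul_le_mul_of_nonneg_left h1 (Nat.cast_nonneg K)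
      _ = K * D ^ 2 * l ^ (2 * a + 2) := by ring
  have hU0 : (0 : ℝ) ≤ unit K (bound n k c) := Nat.cast_nonneg _
  have hW : (((k + 3) * (4 * n.size + 9) : ℕ) : ℝ) ≤ 17 * (a + 3) * l ^ (a + 1) := by
    push_cast
    have h1 : (k : ℝ) + 3 ≤ (a + 3) * l ^ a := by
      have := one a
      linarith
    have h2 : 4 * (n.size : ℝ) + 9 ≤ 17 * l := by linarith
    calc ((k : ℝ) + 3) * (4 * n.size + 9) ≤ ((a + 3) * l ^ a) * (17 * l) :=
          mul_le_mul h1 h2 (by positivity) (by positivity)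
      _ = 17 * (a + 3) * l ^ (a + 1) := by ring
  constructor
  · calc (((k + 3) * (4 * n.size + 9) * unit K (bound n k c) : ℕ) : ℝ)
        = (((k + 3) * (4 * n.size + 9) : ℕ) : ℝ) * unit K (bound n k c) := by push_cast; ring
      _ ≤ (17 * (a + 3) * l ^ (a + 1)) * (K * D ^ 2 * l ^ (2 * a + 2)) :=
          mul_le_mul hW hU hU0 (by positivity)
      _ = C₁ * l ^ (3 * a + 3) := by rw [hC₁]; push_cast; ring
      _ ≤ (C₁ + C₂ + (6 * a + 4) : ℕ) * l ^ (C₁ + C₂ + (6 * a + 4)) := by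
          refine mul_le_mul ?_ (mono (by omega)) (by positivity) (by positivity)
          exact_mod_cast (by omega : C₁ ≤ C₁ + C₂ + (6 * a + 4))
  · set e := ⌈1 / ε⌉₊ with he
    have heX : (e : ℝ) ≤ 2 * X := by
      have h1 := (Nat.ceil_lt_add_one (show 0 ≤ 1 / ε by positivity)).le
      have h2 : 1 / ε ≤ X := le_max_right _ _
      linarith
    have he'X : ((min e n : ℕ) : ℝ) ≤ 2 * X :=
      le_trans (by exact_mod_cast min_le_left e n) heX
    have hmax : (unit K (max (bound n k c) e) : ℝ) ≤
        2 * (K * D ^ 2 * l ^ (2 * a + 2)) + 8 * K * (2 * X) := by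
      have h1 : (unit K (max (bound n k c) e) : ℝ) ≤ 2 * unit K (bound n k c) + 8 * K * e := by
        exact_mod_cast unit_max_le K (bound n k c) e
      have h2 : 8 * (K : ℝ) * e ≤ 8 * K * (2 * X) :=
        mul_le_mul_of_nonneg_left heX (by positivity)
      linarith
    have hmain : (k : ℝ) * (n * (4 * k * ((min e n : ℕ) : ℝ) + 2) * (k * n ^ (c + 1)).size *
        ((((k + 3) * (4 * n.size + 9) : ℕ) : ℝ) + 5)) ≤ A * l ^ (4 * a + 2) * (n * X) := by
      have h1 : 4 * (k : ℝ) * ((min e n : ℕ) : ℝ) + 2 ≤ (8 * a + 2) * l ^ a * X := by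
        have g1 : 4 * (k : ℝ) * ((min e n : ℕ) : ℝ) ≤ 4 * (a * l ^ a) * (2 * X) :=
          mul_le_mul (by linarith) he'X (Nat.cast_nonneg _) (by positivity)
        have g2 : 1 ≤ l ^ a * X := by
          have := one a
          nlinarith
        nlinarith
      have h2 : (((k + 3) * (4 * n.size + 9) : ℕ) : ℝ) + 5 ≤ (17 * a + 56) * l ^ (a + 1) := by
        have := one (a + 1)
        linarith
      calc (k : ℝ) * (n * (4 * k * ((min e n : ℕ) : ℝ) + 2) * (k * n ^ (c + 1)).size *
            ((((k + 3) * (4 * n.size + 9) : ℕ) : ℝ) + 5))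
          ≤ (a * l ^ a) * (n * ((8 * a + 2) * l ^ a * X) * ((a + 2 * c + 2) * l ^ (a + 1)) *
            ((17 * a + 56) * l ^ (a + 1))) := by gcongr
        _ = A * l ^ (4 * a + 2) * (n * X) := by rw [hA]; push_cast; ring
    have hsum : (3 * (k * n ^ (c + 1)).size + 5 +
        (k * (n * (4 * k * ((min e n : ℕ) : ℝ) + 2) * (k * n ^ (c + 1)).size *
        ((((k + 3) * (4 * n.size + 9) : ℕ) : ℝ) + 5)) + k * 4) : ℝ) ≤
        (3 * (a + 2 * c + 2) + 5 + A + 4 * a) * l ^ (4 * a + 2) * (n * X) := by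
      have g : ∀ p : ℕ, p ≤ 4 * a + 2 → l ^ p ≤ l ^ (4 * a + 2) * (n * X) := fun p hp => by
        have := mono hp
        nlinarith [one (4 * a + 2)]
      have h1 := mul_le_mul_of_nonneg_left (g (a + 1) (by omega))
        (show (0 : ℝ) ≤ 3 * (a + 2 * c + 2) by positivity)
      have h2 := g 0 (by omega)
      have h3 := mul_le_mul_of_nonneg_left (g a (by omega)) (show (0 : ℝ) ≤ 4 * a by positivity)
      rw [pow_zero] at h2
      linarith
    have hp : l ^ (2 * a + 2) * (n * X) ≤ l ^ (6 * a + 4) * (n * X) :=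
      mul_le_mul_of_nonneg_right (mono (by omega)) (by positivity)
    have hp' : X ≤ l ^ (6 * a + 4) * (n * X) := by
      have := one (6 * a + 4)
      have hXn : X ≤ n * X := by nlinarith
      nlinarith
    have hp'' : l ^ (2 * a + 2) ≤ l ^ (6 * a + 4) * (n * X) := by
      have := one (2 * a + 2)
      nlinarith
    calc (totalTime K n k e c : ℝ)
        = 2 * unit K (max (bound n k c) e) + (3 * (k * n ^ (c + 1)).size + 5 +
          (k * (n * (4 * k * ((min e n : ℕ) : ℝ) + 2) * (k * n ^ (c + 1)).size *
          ((((k + 3) * (4 * n.size + 9) : ℕ) : ℝ) + 5)) + k * 4)) * unit K (bound n k c) := by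
          unfold totalTime
          push_cast
          ring
      _ ≤ 2 * (2 * (K * D ^ 2 * l ^ (2 * a + 2)) + 8 * K * (2 * X)) +
          ((3 * (a + 2 * c + 2) + 5 + A + 4 * a) * l ^ (4 * a + 2) * (n * X)) *
            (K * D ^ 2 * l ^ (2 * a + 2)) :=
          add_le_add (by linarith) (mul_le_mul hsum hU hU0 (by positivity))
      _ = 4 * (K * D ^ 2) * l ^ (2 * a + 2) + 32 * K * X +
          (3 * (a + 2 * c + 2) + 5 + A + 4 * a) * (K * D ^ 2) *
            (l ^ (6 * a + 4) * (n * X)) := by ring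
      _ ≤ 4 * (K * D ^ 2) * (l ^ (6 * a + 4) * (n * X)) + 32 * K * (l ^ (6 * a + 4) * (n * X)) +
          (3 * (a + 2 * c + 2) + 5 + A + 4 * a) * (K * D ^ 2) *
            (l ^ (6 * a + 4) * (n * X)) := by gcongr
      _ = C₂ * (n * X) * l ^ (6 * a + 4) := by rw [hC₂]; push_cast; ring
      _ ≤ (C₁ + C₂ + (6 * a + 4) : ℕ) * (n * X) * l ^ (C₁ + C₂ + (6 * a + 4)) := by
          refine mul_le_mul (mul_le_mul_of_nonneg_right ?_ (by positivity)) (mono (by omega))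
            (by positivity) (by positivity)
          exact_mod_cast (by omega : C₂ ≤ C₁ + C₂ + (6 * a + 4))

end RAM

/-! ### From one expectation bound to the theorem. -/

open RAM SimpleGraph Levels in
theorem mainTheorem2 (c : ℕ) :
    ∃ P Q : RAM.Prog, ∀ a : ℕ, ∃ C : ℕ,
      ∀ (n k : ℕ) (ε : ℝ), 0 < n → 1 ≤ k → (k : ℝ) ≤ a * (1 + Real.log n) ^ a → 0 < ε →
      ∀ (G : SimpleGraph (Fin n)) (L : AdjList G), ∃ fuel : ℕ,
        (∀ o ∈ (RAM.preprocess L P k ε fuel).support,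
          ∃ (s : RAM.State) (H : SimpleGraph (Fin n)), o = some s ∧
            (s.time : ℝ) ≤ C * (n * max 1 (1 / ε)) * (1 + Real.log n) ^ C ∧
            H ≤ G ∧
            RAM.IsAdjacencyOracle L Q s.mem (C * (1 + Real.log n) ^ C) H) ∧
        1 - 1 / (n : ℝ≥0∞) ^ c ≤
          (RAM.preprocess L P k ε fuel).toOuterMeasure
            {o | ∃ (s : RAM.State) (H : SimpleGraph (Fin n)), o = some s ∧
              RAM.IsAdjacencyOracle L Q s.mem (C * (1 + Real.log n) ^ C) H ∧
              IsConnectivityCertificate G H k ∧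
              (H.edgeSet.ncard : ℝ) ≤ (1 + ε) * k * n} := by
  set K := 1000 + (powExp (c + 1)).wt with hK
  refine ⟨prepare c, query, fun a => ?_⟩
  obtain ⟨C, hC⟩ := exists_time_bound K c a
  refine ⟨C, fun n k ε hn hk hka hε G L => ⟨bound n k c + 1, ?_⟩⟩
  obtain ⟨hτ, htime⟩ := hC n k ε hn hk hka hε
  set e := ⌈1 / ε⌉₊ with he
  have he0 : 0 < e := Nat.ceil_pos.2 (by positivity)
  have hM1 : 1 ≤ bound n k c := by
    unfold bound
    exact Nat.mul_pos (by positivity) (Nat.mul_pos hk (by positivity))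
  set β : ℝ := 1 / (k * n ^ c : ℕ) with hβ
  set J : State → Levels n → Prop := fun s b =>
    (∃ Z, Good G k Z (bound n k c) k b s.reg s.mem) ∧ s.time ≤ totalTime K n k e c with hJ
  -- At level `k` the bound `failure` is 0 for sparse levels and 1 otherwise, so `f` is finite
  -- exactly if some levels satisfy `J`, and at least 1 if none of these are sparse.
  set f : State → ℝ≥0∞ := fun s => ⨅ b, ⨅ (_ : J s b), Levels.failure G (min e n) k β k b with hf
  set μ := preprocess L (prepare c) k ε (bound n k c + 1) with hμ
  have hwp : μ.expect (fun o => o.elim ⊤ f) ≤ 1 / (n : ℝ≥0∞) ^ c :=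
    wp_prepare_le (L := L) hn hk he0 hK.ge fun Z a' r' m' t' hg ht =>
      iInf₂_le a' ⟨⟨Z, hg⟩, ht⟩
  have horacle : ∀ s b, J s b → IsAdjacencyOracle L query s.mem (C * (1 + Real.log n) ^ C)
      (G \ b.rest G k) := by
    rintro s b ⟨⟨Z, hg⟩, -⟩
    exact isAdjacencyOracle_query (by omega) hM1 hg.bdd.nodes hg.bdd.mem hg.represents hg.valid hτ
  have hfin : (1 : ℝ≥0∞) / (n : ℝ≥0∞) ^ c ≠ ⊤ := by
    refine ENNReal.div_ne_top ENNReal.one_ne_top (pow_ne_zero _ ?_)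
    exact_mod_cast hn.ne'
  constructor
  · intro o ho
    -- An outcome of positive probability with infinite value would make the expectation infinite.
    have hne : o.elim ⊤ f ≠ ⊤ := by
      intro htop
      have h1 : μ o * o.elim ⊤ f ≤ μ.expect fun o => o.elim ⊤ f :=
        ENNReal.le_tsum (f := fun o => μ o * o.elim ⊤ f) o
      rw [htop, ENNReal.mul_top ((PMF.mem_support_iff _ _).1 ho)] at h1
      exact hfin (top_le_iff.1 (h1.trans hwp))
    rcases o with _ | s
    · exact absurd rfl hne
    · obtain ⟨b, hb⟩ := exists_of_iInf_iInf_ne_top hne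
      refine ⟨s, G \ b.rest G k, rfl, le_trans ?_ htime, sdiff_le, horacle s b hb⟩
      exact_mod_cast hb.2
  · set S : Set (Option State) := {o | ∃ (s : RAM.State) (H : SimpleGraph (Fin n)), o = some s ∧
      RAM.IsAdjacencyOracle L query s.mem (C * (1 + Real.log n) ^ C) H ∧
      IsConnectivityCertificate G H k ∧ (H.edgeSet.ncard : ℝ) ≤ (1 + ε) * k * n} with hS
    have hbad : ∀ o ∉ S, 1 ≤ o.elim ⊤ f := by
      intro o ho
      rcases o with _ | s
      · exact le_top
      · refine le_iInf₂ fun b hb => ?_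
        have hns : ¬Sparse G (min e n) k b := by
          intro hs
          obtain ⟨Z, hg⟩ := hb.1
          exact ho ⟨s, G \ b.rest G k, rfl, horacle s b hb, isConnectivityCertificate hg.valid,
            card_edgeFinset_le hg.valid hn hε hs⟩
        unfold Levels.failure
        rw [if_neg hns]
    -- Markov's inequality for `f`, which is at least 1 outside of `S`.
    have hcompl : μ.toOuterMeasure Sᶜ ≤ 1 / (n : ℝ≥0∞) ^ c := by
      refine le_trans ?_ hwp
      rw [PMF.toOuterMeasure_apply, PMF.expect]
      refine ENNReal.tsum_le_tsum fun o => ?_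
      by_cases ho : o ∈ S
      · simp [ho]
      · rw [Set.indicator_of_mem (show o ∈ Sᶜ from ho)]
        exact le_mul_of_one_le_right' (hbad o ho)
    have htotal : 1 ≤ μ.toOuterMeasure S + μ.toOuterMeasure Sᶜ := by
      rw [PMF.toOuterMeasure_apply, PMF.toOuterMeasure_apply, ← ENNReal.tsum_add, ← μ.tsum_coe]
      refine ENNReal.tsum_le_tsum fun o => ?_
      by_cases ho : o ∈ S
      · simp [ho]
      · simp [ho]
    rw [tsub_le_iff_right]
    exact htotal.trans (add_le_add le_rfl hcompl)
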